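/- Let $k$ be a field of characteristic $0$ and let $Ch(k)$ be the dg category of (unbounded) cochain complexes of $k$-vector spaces. For a dg category $\mathcal T$ over $k$, a (right) $\mathcal T$-module is a dg functor $\mathcal T^{op}\to Ch(k)$. A morphism of $\mathcal T$-modules is a closed dg natural transformation of degree $0$. It is a weak equivalence if it is pointwise a quasi-isomorphism and a fibration if it is pointwise surjective; cofibrations are the morphisms with the left lifting property against the fibrations that are weak equivalences. Two modules are called weakly equivalent if they are connected by a zigzag of weak equivalences, and $\Sigma M$ denotes the pointwise shift of $M$. A dg functor $F:\mathcal T\to\mathcal T'$ is a DK-embedding (or quasi-fully faithful) if $\mathcal T(x,y)\to\mathcal T'(Fx,Fy)$ is a quasi-isomorphism for all objects $x,y$ of $\mathcal T$. A dg category $\mathcal T$ is pretriangulated if 1. there is an object $0$ of $\mathcal T$ such that $\mathcal T(-,0)$ is weakly equivalent to the zero module; 2. whenever $M$ is a $\mathcal T$-module such that $\Sigma M$ is weakly equivalent to a representable module, $M$ is weakly equivalent to a representable module; 3. whenever $M$ and $N$ are $\mathcal T$-modules weakly equivalent to representable modules, the homotopy cofiber (pointwise mapping cone) of every morphism of modules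 $M\to N$ is weakly equivalent to a representable module. **Proposition.** Every small dg category $\mathcal T$ over $k$ admits a DK-embedding into a small pretriangulated dg category. More precisely, for a set $S$ let $\tilde{\mathcal T}_S$ be the small full dg subcategory of the dg category $Fun_{dg}(\mathcal T^{op},Ch(k))$ of $\mathcal T$-modules whose objects are the cofibrant and fibrant modules $M$ such that the underlying set of $M(x)^n$ is a subset of $S$ for every object $x$ of $\mathcal T$ and every integer $n$. There is a cardinal $\kappa$, depending on $\mathcal T$, such that for every set $S$ of cardinality at least $\kappa$ the dg category $\tilde{\mathcal T}_S$ is pretriangulated and there is a DK-embedding $\mathcal T\to\tilde{\mathcal T}_S$. -/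

import Mathlib

open CategoryTheory CochainComplex.HomComplex

universe w w₁ w₂ w₃ u

/-- A dg category over `k`: a type of objects, a cochain complex of `k`-modules `Hom x y` for every
pair of objects, bilinear compositions compatible with the differentials, and units.
The composition is written in diagrammatic order: `comp h f g` is `g ∘ f`, so that the condition
`d_comp`, that is `d (g ∘ f) = d g ∘ f + (-1) ^ |g| • g ∘ d f`, says that
`Hom y z ⊗ Hom x y ⟶ Hom x z` is a morphism of complexes, and `d_one` says that
`k ⟶ Hom x x` is a morphism of complexes. -/
structure DGCat (k : Type u) [Field k] where
  /-- the objects -/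
  Ob : Type w
  /-- the complexes of morphisms -/
  Hom : Ob → Ob → CochainComplex (ModuleCat.{u} k) ℤ
  /-- the composition, in diagrammatic order -/
  comp : ∀ {x y z : Ob} {p q n : ℤ}, p + q = n →
    ((Hom x y).X p →ₗ[k] (Hom y z).X q →ₗ[k] (Hom x z).X n)
  /-- the units -/
  one : ∀ x : Ob, (Hom x x).X 0
  d_comp : ∀ {x y z : Ob} {p q n : ℤ} (h : p + q = n) (f : (Hom x y).X p) (g : (Hom y z).X q),
    (Hom x z).d n (n + 1) (comp h f g) =
      comp (show p + (q + 1) = n + 1 by omega) f ((Hom y z).d q (q + 1) g) +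
        q.negOnePow • comp (show (p + 1) + q = n + 1 by omega) ((Hom x y).d p (p + 1) f) g
  d_one : ∀ x : Ob, (Hom x x).d 0 1 (one x) = 0
  one_comp : ∀ {x y : Ob} {p : ℤ} (f : (Hom x y).X p), comp (zero_add p) (one x) f = f
  comp_one : ∀ {x y : Ob} {p : ℤ} (f : (Hom x y).X p), comp (add_zero p) f (one y) = f
  assoc : ∀ {x y z t : Ob} {p q r pq qr n : ℤ} (hpq : p + q = pq) (hqr : q + r = qr)
    (h : pq + r = n) (h' : p + qr = n)
    (f : (Hom x y).X p) (g : (Hom y z).X q) (e : (Hom z t).X r),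
    comp h (comp hpq f g) e = comp h' f (comp hqr g e)

/-- A dg functor: a map on objects and morphisms of complexes between the complexes of morphisms,
compatible with units and compositions. -/
structure DGFunctor {k : Type u} [Field k] (A : DGCat.{w₁} k) (B : DGCat.{w₂} k) where
  /-- the map on objects -/
  obj : A.Ob → B.Ob
  /-- the maps on the complexes of morphisms -/
  map : ∀ x y : A.Ob, A.Hom x y ⟶ B.Hom (obj x) (obj y)
  map_one : ∀ x : A.Ob, (map x x).f 0 (A.one x) = B.one (obj x)
  map_comp : ∀ {x y z : A.Ob} {p q n : ℤ} (h : p + q = n)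
    (f : (A.Hom x y).X p) (g : (A.Hom y z).X q),
    (map x z).f n (A.comp h f g) = B.comp h ((map x y).f p f) ((map y z).f q g)

section

variable {k : Type u} [Field k]

/-- A dg functor is a DK-embedding (or quasi-fully faithful) if it induces quasi-isomorphisms on
all complexes of morphisms. -/
def DGFunctor.IsDKEmbedding {A : DGCat.{w₁} k} {B : DGCat.{w₂} k} (F : DGFunctor A B) : Prop :=
  ∀ x y : A.Ob, QuasiIso (F.map x y)

/-- The composition of dg functors, in diagrammatic order. -/
def DGFunctor.comp {A : DGCat.{w₁} k} {B : DGCat.{w₂} k} {C : DGCat.{w₃} k}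
    (F : DGFunctor A B) (G : DGFunctor B C) : DGFunctor A C where
  obj x := G.obj (F.obj x)
  map x y := F.map x y ≫ G.map (F.obj x) (F.obj y)
  map_one x := by simp [F.map_one, G.map_one]
  map_comp h f g := by simp [F.map_comp h, G.map_comp h]

lemma negOnePow_smul_smul {M : Type*} [AddCommGroup M] (a b : ℤ) (x : M) :
    a.negOnePow • b.negOnePow • x = (a + b).negOnePow • x := by
  rw [smul_smul, ← Int.negOnePow_add]

lemma negOnePow_smul_congr {M : Type*} [AddCommGroup M] {a b : ℤ} (h : Even (a - b)) (x : M) :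
    a.negOnePow • x = b.negOnePow • x := by
  rw [(Int.negOnePow_eq_iff a b).2 h]

lemma map_negOnePow_smul {M N : Type*} [AddCommGroup M] [AddCommGroup N] [Module k M] [Module k N]
    (φ : M →ₗ[k] N) (a : ℤ) (x : M) : φ (a.negOnePow • x) = a.negOnePow • φ x := by
  rw [Units.smul_def, Units.smul_def, map_zsmul]

lemma map_negOnePow_smul₂ {M N P : Type*} [AddCommGroup M] [AddCommGroup N] [AddCommGroup P]
    [Module k M] [Module k N] [Module k P]
    (φ : M →ₗ[k] N →ₗ[k] P) (a : ℤ) (x : M) (y : N) :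
    φ (a.negOnePow • x) y = a.negOnePow • φ x y :=
  map_negOnePow_smul (φ.flip y) a x

/-- The sign `(-1) ^ a` acting linearly. -/
def signSMul (M : Type*) [AddCommGroup M] [Module k M] (a : ℤ) : M →ₗ[k] M where
  toFun x := a.negOnePow • x
  map_add' x y := smul_add _ x y
  map_smul' c x := by
    rw [Units.smul_def, Units.smul_def, RingHom.id_apply]
    exact smul_comm _ _ _

@[simp]
lemma signSMul_apply (M : Type*) [AddCommGroup M] [Module k M] (a : ℤ) (x : M) :
    signSMul (k := k) M a x = a.negOnePow • x := rfl

/-- The opposite dg category, with the Koszul sign in the composition. -/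
def DGCat.op (A : DGCat.{w} k) : DGCat.{w} k where
  Ob := A.Ob
  Hom x y := A.Hom y x
  comp {x y z p q n} h :=
    ((A.comp (show q + p = n by omega)).flip).compr₂ (signSMul (k := k) _ (p * q))
  one := A.one
  d_comp {x y z p q n} h f g := by
    simp only [LinearMap.compr₂_apply, LinearMap.flip_apply, signSMul_apply]
    rw [map_negOnePow_smul, A.d_comp, smul_add, negOnePow_smul_smul, negOnePow_smul_smul]
    refine (add_comm _ _).trans ?_
    congr 1
    · exact negOnePow_smul_congr ⟨0, by ring⟩ _
    · exact negOnePow_smul_congr ⟨-q, by ring⟩ _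
  d_one := A.d_one
  one_comp f := by simp [A.comp_one]
  comp_one f := by simp [A.one_comp]
  assoc {x y z t p q r pq qr n} hpq hqr h h' f g e := by
    simp only [LinearMap.compr₂_apply, LinearMap.flip_apply, signSMul_apply]
    rw [map_negOnePow_smul, map_negOnePow_smul₂, negOnePow_smul_smul, negOnePow_smul_smul,
      A.assoc (by omega) (by omega) (by omega) (show r + pq = n by omega)]
    exact negOnePow_smul_congr ⟨0, by subst hpq hqr; ring⟩ _

/-- The full dg subcategory on a family of objects. -/
def DGCat.full (A : DGCat.{w} k) {I : Type w₁} (e : I → A.Ob) : DGCat.{w₁} k where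
  Ob := I
  Hom x y := A.Hom (e x) (e y)
  comp h := A.comp h
  one x := A.one (e x)
  d_comp h f g := A.d_comp h f g
  d_one x := A.d_one (e x)
  one_comp f := A.one_comp f
  comp_one f := A.comp_one f
  assoc hpq hqr h h' f g e := A.assoc hpq hqr h h' f g e

/-- The inclusion of a full dg subcategory. -/
def DGCat.incl (A : DGCat.{w} k) {I : Type w₁} (e : I → A.Ob) : DGFunctor (A.full e) A where
  obj := e
  map x y := 𝟙 (A.Hom (e x) (e y))
  map_one _ := rfl
  map_comp _ _ _ := rfl

variable (k) in
/-- The dg category of cochain complexes of `k`-vector spaces. The degree `n` part of the complex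
of morphisms from `K` to `L` consists of the families of linear maps `K.X p ⟶ L.X (p + n)`, with
the differential `δ γ = d ∘ γ - (-1) ^ n • γ ∘ d`. -/
def DGCat.ch : DGCat.{u + 1} k where
  Ob := CochainComplex (ModuleCat.{u} k) ℤ
  Hom K L :=
    { X := fun n => ModuleCat.of k (Cochain K L n)
      d := fun n m => ModuleCat.ofHom (δ_hom k K L n m)
      shape := fun n m h => by
        refine ModuleCat.hom_ext (LinearMap.ext fun z => ?_)
        exact δ_shape n m h z
      d_comp_d' := fun a b c _ _ => by
        refine ModuleCat.hom_ext (LinearMap.ext fun z => ?_)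
        exact δ_δ a b c z }
  comp h := LinearMap.mk₂ k (fun f g => Cochain.comp f g h)
    (fun f f' g => Cochain.add_comp f f' g h) (fun c f g => Cochain.smul_comp c f g h)
    (fun f g g' => Cochain.comp_add f g g' h) (fun c f g => Cochain.comp_smul f c g h)
  one K := Cochain.ofHom (𝟙 K)
  d_comp {x y z p q n} h f g := δ_comp f g h (p + 1) (q + 1) (n + 1) rfl rfl rfl
  d_one K := δ_ofHom (𝟙 K)
  one_comp f := Cochain.id_comp f
  comp_one f := Cochain.comp_id f
  assoc {x y z t p q r pq qr n} hpq hqr h h' f g e := Cochain.comp_assoc f g e hpq hqr (by omega)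

/-- The degree `n` dg natural transformations `F ⟶ G`: families `α x : F x ⟶ G x` of degree `n`
such that `α y ∘ F f = (-1) ^ (n |f|) • G f ∘ α x` for all `f : x ⟶ y`. -/
def DGFunctor.natTrans {A : DGCat.{w₁} k} {B : DGCat.{w₂} k} (F G : DGFunctor A B) (n : ℤ) :
    Submodule k (∀ x : A.Ob, (B.Hom (F.obj x) (G.obj x)).X n) where
  carrier := {α | ∀ (x y : A.Ob) (p m : ℤ) (h : p + n = m) (f : (A.Hom x y).X p),
    B.comp h ((F.map x y).f p f) (α y) =
      (n * p).negOnePow • B.comp (show n + p = m by omega) (α x) ((G.map x y).f p f)}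
  add_mem' {α β} hα hβ x y p m h f := by
    simp only [Pi.add_apply, map_add, LinearMap.add_apply, smul_add]
    rw [hα x y p m h f, hβ x y p m h f]
  zero_mem' x y p m h f := by simp
  smul_mem' c α hα x y p m h f := by
    simp only [Pi.smul_apply, map_smul, LinearMap.smul_apply]
    rw [hα x y p m h f, Units.smul_def, Units.smul_def]
    exact smul_comm _ _ _

lemma DGFunctor.natTrans_d {A : DGCat.{w₁} k} {B : DGCat.{w₂} k} {F G : DGFunctor A B} {n : ℤ}
    {α : ∀ x : A.Ob, (B.Hom (F.obj x) (G.obj x)).X n} (hα : α ∈ F.natTrans G n) (n' : ℤ) :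
    (fun x => (B.Hom (F.obj x) (G.obj x)).d n n' (α x)) ∈ F.natTrans G n' := by
  by_cases hn : n + 1 = n'
  · subst hn
    intro x y p m h f
    obtain rfl : m = p + n + 1 := by omega
    have h₁ := hα x y p (p + n) rfl f
    have h₂ := hα x y (p + 1) (p + n + 1) (by omega) ((A.Hom x y).d p (p + 1) f)
    have h₃ := congrArg ((B.Hom (F.obj x) (G.obj y)).d (p + n) (p + n + 1)) h₁
    have hF := congrArg (fun φ => φ f) (congrArg ModuleCat.Hom.hom ((F.map x y).comm p (p + 1)))
    have hG := congrArg (fun φ => φ f) (congrArg ModuleCat.Hom.hom ((G.map x y).comm p (p + 1)))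
    simp only [ModuleCat.hom_comp, LinearMap.comp_apply] at hF hG
    rw [map_negOnePow_smul, B.d_comp, B.d_comp] at h₃
    erw [hF, hG] at h₃
    erw [h₂] at h₃
    rw [smul_add, negOnePow_smul_smul, negOnePow_smul_smul] at h₃
    replace h₃ := (add_comm _ _).trans h₃
    rw [negOnePow_smul_congr (b := n * p) ⟨n, by ring⟩] at h₃
    have h₄ := add_left_cancel h₃
    refine h₄.trans (negOnePow_smul_congr ⟨0, by ring⟩ _)
  · have : (fun x => (B.Hom (F.obj x) (G.obj x)).d n n' (α x)) = 0 := by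
      funext x
      rw [(B.Hom (F.obj x) (G.obj x)).shape n n' hn]
      rfl
    rw [this]
    exact Submodule.zero_mem _

/-- The complex of dg natural transformations, with the pointwise differential. -/
def DGFunctor.natComplex {A : DGCat.{u} k} {B : DGCat.{w} k} (F G : DGFunctor A B) :
    CochainComplex (ModuleCat.{u} k) ℤ where
  X n := ModuleCat.of k (F.natTrans G n)
  d n m := ModuleCat.ofHom
    { toFun := fun α => ⟨fun x => (B.Hom (F.obj x) (G.obj x)).d n m (α.1 x),
        DGFunctor.natTrans_d α.2 m⟩
      map_add' := fun α β => Subtype.ext (funext fun x =>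
        map_add ((B.Hom (F.obj x) (G.obj x)).d n m).hom (α.1 x) (β.1 x))
      map_smul' := fun c α => Subtype.ext (funext fun x =>
        map_smul ((B.Hom (F.obj x) (G.obj x)).d n m).hom c (α.1 x)) }
  shape n m h := by
    refine ModuleCat.hom_ext (LinearMap.ext fun α => Subtype.ext (funext fun x => ?_))
    change (B.Hom (F.obj x) (G.obj x)).d n m (α.1 x) = 0
    rw [(B.Hom (F.obj x) (G.obj x)).shape n m h]
    rfl
  d_comp_d' a b c _ _ := by
    refine ModuleCat.hom_ext (LinearMap.ext fun α => Subtype.ext (funext fun x => ?_))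
    exact congrArg (fun φ => φ (α.1 x)) (congrArg ModuleCat.Hom.hom
      ((B.Hom (F.obj x) (G.obj x)).d_comp_d a b c))

lemma DGFunctor.natTrans_comp {A : DGCat.{w₁} k} {B : DGCat.{w₂} k} {F G H : DGFunctor A B}
    {p q n : ℤ} (h : p + q = n)
    {α : ∀ x : A.Ob, (B.Hom (F.obj x) (G.obj x)).X p} (hα : α ∈ F.natTrans G p)
    {β : ∀ x : A.Ob, (B.Hom (G.obj x) (H.obj x)).X q} (hβ : β ∈ G.natTrans H q) :
    (fun x => B.comp h (α x) (β x)) ∈ F.natTrans H n := by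
  intro x y r m hm f
  rw [← B.assoc (show r + p = r + p by rfl) h (by omega) hm, hα x y r (r + p) rfl f,
    map_negOnePow_smul₂,
    B.assoc (show p + r = r + p by omega) (show r + q = r + q by rfl) (by omega)
      (show p + (r + q) = m by omega),
    hβ x y r (r + q) rfl f, map_negOnePow_smul, negOnePow_smul_smul,
    ← B.assoc h (show q + r = r + q by omega) (by omega) (by omega)]
  exact negOnePow_smul_congr ⟨0, by subst h; ring⟩ _

/-- The pointwise composition of dg natural transformations. -/
def DGFunctor.natComp {A : DGCat.{w₁} k} {B : DGCat.{w₂} k} (F G H : DGFunctor A B)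
    {p q n : ℤ} (h : p + q = n) :
    F.natTrans G p →ₗ[k] G.natTrans H q →ₗ[k] F.natTrans H n :=
  LinearMap.mk₂ k
    (fun α β => ⟨fun x => B.comp h (α.1 x) (β.1 x), DGFunctor.natTrans_comp h α.2 β.2⟩)
    (fun α α' β => Subtype.ext (funext fun x =>
      LinearMap.map_add₂ (B.comp h) (α.1 x) (α'.1 x) (β.1 x)))
    (fun c α β => Subtype.ext (funext fun x =>
      LinearMap.map_smul₂ (B.comp h) c (α.1 x) (β.1 x)))
    (fun α β β' => Subtype.ext (funext fun x =>
      map_add (B.comp h (α.1 x)) (β.1 x) (β'.1 x)))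
    (fun c α β => Subtype.ext (funext fun x =>
      map_smul (B.comp h (α.1 x)) c (β.1 x)))

/-- The dg category of dg functors from a small dg category `A` to `B`. -/
def DGCat.functors (A : DGCat.{u} k) (B : DGCat.{w} k) : DGCat.{max u w} k where
  Ob := DGFunctor A B
  Hom F G := F.natComplex G
  comp {F G H p q n} h := F.natComp G H h
  one F := ⟨fun x => B.one (F.obj x), fun x y p m h f => by
    obtain rfl : p = m := by omega
    simp [B.comp_one, B.one_comp]⟩
  d_comp h α β := Subtype.ext (funext fun x => B.d_comp h (α.1 x) (β.1 x))
  d_one F := Subtype.ext (funext fun x => B.d_one (F.obj x))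
  one_comp α := Subtype.ext (funext fun x => B.one_comp (α.1 x))
  comp_one α := Subtype.ext (funext fun x => B.comp_one (α.1 x))
  assoc hpq hqr h h' α β γ :=
    Subtype.ext (funext fun x => B.assoc hpq hqr h h' (α.1 x) (β.1 x) (γ.1 x))

variable {T : DGCat.{w} k}

variable (T) in
/-- Right modules over a dg category `T`: dg functors from the opposite of `T` to complexes. -/
abbrev DGModule := DGFunctor T.op (DGCat.ch k)

namespace DGModule

/-- The complex `M(x)` underlying a module at an object `x`. -/
abbrev cx (M : DGModule T) (x : T.Ob) : CochainComplex (ModuleCat.{u} k) ℤ := M.obj x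

/-- The cochain `M(x) ⟶ M(y)` by which a morphism `f : y ⟶ x` of degree `n` acts on a module. -/
def act (M : DGModule T) {x y : T.Ob} {n : ℤ} (f : (T.Hom y x).X n) :
    Cochain (M.cx x) (M.cx y) n :=
  (M.map x y).f n f

/-- Construction of a module from its complexes and the action. -/
def ofAct (cx : T.Ob → CochainComplex (ModuleCat.{u} k) ℤ)
    (act : ∀ (x y : T.Ob) (n : ℤ), (T.Hom y x).X n →ₗ[k] Cochain (cx x) (cx y) n)
    (act_one : ∀ x, act x x 0 (T.one x) = Cochain.ofHom (𝟙 (cx x)))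
    (act_comp : ∀ {x y z : T.Ob} {p q n : ℤ} (h : p + q = n) (h' : q + p = n)
      (f : (T.Hom y x).X p) (g : (T.Hom z y).X q),
      (p * q).negOnePow • act x z n (T.comp h' g f) = (act x y p f).comp (act y z q g) h)
    (act_d : ∀ (x y : T.Ob) (n : ℤ) (f : (T.Hom y x).X n),
      δ n (n + 1) (act x y n f) = act x y (n + 1) ((T.Hom y x).d n (n + 1) f)) :
    DGModule T where
  obj := cx
  map x y :=
    { f := fun n => ModuleCat.ofHom (act x y n)
      comm' := fun n m h => by
        obtain rfl : n + 1 = m := h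
        refine ModuleCat.hom_ext (LinearMap.ext fun f => ?_)
        exact act_d x y n f }
  map_one := act_one
  map_comp {x y z p q n} h f g :=
    (map_negOnePow_smul (act x z n) (p * q) _).trans (act_comp h (by omega) f g)

/-- The action on a module, as a linear map. -/
def actₗ (M : DGModule T) (x y : T.Ob) (n : ℤ) :
    (T.Hom y x).X n →ₗ[k] Cochain (M.cx x) (M.cx y) n :=
  ((M.map x y).f n).hom

@[simp]
lemma actₗ_apply (M : DGModule T) {x y : T.Ob} {n : ℤ} (f : (T.Hom y x).X n) :
    M.actₗ x y n f = M.act f := rfl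

lemma act_add (M : DGModule T) {x y : T.Ob} {n : ℤ} (f g : (T.Hom y x).X n) :
    M.act (f + g) = M.act f + M.act g := map_add (M.actₗ x y n) f g

lemma act_smul (M : DGModule T) {x y : T.Ob} {n : ℤ} (c : k) (f : (T.Hom y x).X n) :
    M.act (c • f) = c • M.act f := map_smul (M.actₗ x y n) c f

lemma act_one (M : DGModule T) (x : T.Ob) : M.act (T.one x) = Cochain.ofHom (𝟙 (M.cx x)) :=
  M.map_one x

lemma act_comp (M : DGModule T) {x y z : T.Ob} {p q n : ℤ} (h : p + q = n) (h' : q + p = n)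
    (f : (T.Hom y x).X p) (g : (T.Hom z y).X q) :
    (p * q).negOnePow • M.act (T.comp h' g f) = (M.act f).comp (M.act g) h :=
  (map_negOnePow_smul ((M.map x z).f n).hom (p * q) _).symm.trans (M.map_comp h f g)

lemma act_d (M : DGModule T) {x y : T.Ob} {n : ℤ} (f : (T.Hom y x).X n) :
    δ n (n + 1) (M.act f) = M.act ((T.Hom y x).d n (n + 1) f) :=
  congrArg (fun φ => φ f) (congrArg ModuleCat.Hom.hom ((M.map x y).comm n (n + 1)))

/-- Morphisms of modules: the closed dg natural transformations of degree `0`, that is, morphisms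
of complexes `M(x) ⟶ N(x)` commuting with the action. -/
@[ext]
structure Hom (M N : DGModule T) where
  /-- the morphisms of complexes -/
  app : ∀ x : T.Ob, M.cx x ⟶ N.cx x
  naturality : ∀ {x y : T.Ob} {n : ℤ} (f : (T.Hom y x).X n),
    (M.act f).comp (Cochain.ofHom (app y)) (add_zero n) =
      (Cochain.ofHom (app x)).comp (N.act f) (zero_add n)

instance : Category (DGModule T) where
  Hom M N := Hom M N
  id M := ⟨fun x => 𝟙 (M.cx x), fun f => by simp⟩
  comp {M N P} φ ψ := ⟨fun x => φ.app x ≫ ψ.app x, fun {x y n} f => by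
    rw [Cochain.ofHom_comp, Cochain.ofHom_comp,
      ← Cochain.comp_assoc_of_third_is_zero_cochain, φ.naturality f,
      Cochain.comp_assoc_of_first_is_zero_cochain, ψ.naturality f,
      Cochain.comp_assoc_of_first_is_zero_cochain]⟩
  id_comp φ := Hom.ext (funext fun x => Category.id_comp (φ.app x))
  comp_id φ := Hom.ext (funext fun x => Category.comp_id (φ.app x))
  assoc φ ψ χ := Hom.ext (funext fun x => Category.assoc (φ.app x) (ψ.app x) (χ.app x))

/-- Weak equivalences of modules are the pointwise quasi-isomorphisms. -/
def IsWeakEquiv {M N : DGModule T} (φ : M ⟶ N) : Prop :=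
  ∀ x : T.Ob, QuasiIso (Hom.app φ x)

/-- Fibrations of modules are the pointwise surjections. -/
def IsFibration {M N : DGModule T} (φ : M ⟶ N) : Prop :=
  ∀ (x : T.Ob) (n : ℤ), Function.Surjective ((Hom.app φ x).f n)

/-- Cofibrations are the morphisms with the left lifting property against the fibrations that
are weak equivalences. -/
def IsCofibration {M N : DGModule T} (φ : M ⟶ N) : Prop :=
  ∀ ⦃P Q : DGModule T⦄ (ψ : P ⟶ Q), IsFibration ψ → IsWeakEquiv ψ → HasLiftingProperty φ ψ

/-- Two modules are weakly equivalent if they are connected by a zigzag of weak equivalences. -/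
def WeaklyEquivalent (M N : DGModule T) : Prop :=
  Relation.EqvGen (fun P Q : DGModule T => ∃ φ : P ⟶ Q, IsWeakEquiv φ) M N

variable (T) in
/-- The zero module. -/
noncomputable def zero : DGModule T :=
  ofAct (fun _ => HomologicalComplex.zero) (fun _ _ _ => 0)
    (fun x => by
      rw [(CategoryTheory.Limits.IsZero.iff_id_eq_zero _).1
        (HomologicalComplex.isZero_zero (V := ModuleCat.{u} k) (c := ComplexShape.up ℤ)),
        Cochain.ofHom_zero]
      rfl) (by simp) (by simp)

/-- A module is cofibrant if the morphism from the zero module is a cofibration. -/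
def IsCofibrant (M : DGModule T) : Prop :=
  IsCofibration (M := zero T) (N := M) ⟨fun _ => 0, by simp⟩

/-- A module is fibrant if the morphism to the zero module is a fibration. -/
def IsFibrant (M : DGModule T) : Prop :=
  IsFibration (M := M) (N := zero T) ⟨fun _ => 0, by simp⟩

/-- The representable module `T(-, c)`, on which a morphism `f` acts by
`g ↦ (-1) ^ (|f| |g|) • g ∘ f`. -/
def representable (c : T.Ob) : DGModule T :=
  ofAct (fun x => T.Hom x c)
    (fun x y n =>
      { toFun := fun f => Cochain.mk fun p q h => ModuleCat.ofHom
          ((signSMul (k := k) _ (n * p)).comp (T.comp (show n + p = q by omega) f))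
        map_add' := fun f g => by
          ext p q h a
          simp
        map_smul' := fun r f => by
          ext p q h a
          simp only [map_smul, LinearMap.comp_smul]
          rfl })
    (fun x => by
      ext p a
      simp [T.one_comp])
    (fun {x y z p q n} h h' f g => by
      ext a b hab e
      rw [Cochain.comp_v _ _ h a (a + p) b rfl (by omega)]
      change (p * q).negOnePow • (n * a).negOnePow • T.comp _ (T.comp h' g f) e =
        (q * (a + p)).negOnePow • T.comp _ g ((p * a).negOnePow • T.comp _ f e)
      rw [map_negOnePow_smul, negOnePow_smul_smul, negOnePow_smul_smul,
        T.assoc h' (show p + a = a + p by omega) (by omega) (by omega)]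
      exact negOnePow_smul_congr ⟨0, by subst h; ring⟩ _)
    (fun x y n f => by
      ext a b hab e
      rw [δ_v n (n + 1) rfl _ a b hab (a + n) (a + 1) (by omega) rfl]
      obtain rfl : b = a + n + 1 := by omega
      change (T.Hom y c).d (a + n) (a + n + 1) ((n * a).negOnePow • T.comp _ f e) +
        (n + 1).negOnePow • (n * (a + 1)).negOnePow • T.comp _ f ((T.Hom x c).d a (a + 1) e) =
        ((n + 1) * a).negOnePow • T.comp _ ((T.Hom y x).d n (n + 1) f) e
      rw [map_negOnePow_smul (((T.Hom y c).d (a + n) (a + n + 1)).hom), T.d_comp, smul_add,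
        negOnePow_smul_smul, negOnePow_smul_smul,
        negOnePow_smul_congr (a := n + 1 + n * (a + 1)) (b := n * a + 1) ⟨n, by ring⟩,
        Int.negOnePow_succ, Units.neg_smul,
        negOnePow_smul_congr (a := n * a + a) (b := (n + 1) * a) ⟨0, by ring⟩]
      abel)

/-- The suspension `Σ M`: the pointwise shift `(Σ M)(x) = M(x)[1]`, on which a morphism `f` acts
as `(-1) ^ |f|` times its action on `M`. -/
noncomputable def suspension (M : DGModule T) : DGModule T :=
  ofAct (fun x => (CategoryTheory.shiftFunctor _ (1 : ℤ)).obj (M.cx x))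
    (fun x y n => (signSMul (k := k) _ n).comp
      ((Cochain.shiftLinearMap k (M.cx x) (M.cx y) n 1).comp (M.actₗ x y n)))
    (fun x => by
      ext p : 1
      change (0 : ℤ).negOnePow • ((M.act (T.one x)).shift 1).v p p (add_zero p) = _
      rw [act_one, Int.negOnePow_zero, one_smul, Cochain.shift_v', Cochain.ofHom_v]
      simp)
    (fun {x y z p q n} h h' f g => by
      change (p * q).negOnePow • n.negOnePow • (M.act (T.comp h' g f)).shift 1 =
        (p.negOnePow • (M.act f).shift 1).comp (q.negOnePow • (M.act g).shift 1) h
      rw [Cochain.units_smul_comp, Cochain.comp_units_smul, negOnePow_smul_smul,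
        negOnePow_smul_smul, h, add_comm (p * q), ← negOnePow_smul_smul, ← Cochain.shift_units_smul,
        M.act_comp h h']
      congr 1
      ext a b hab : 1
      rw [Cochain.comp_v _ _ h a (a + p) b rfl (by omega), Cochain.shift_v', Cochain.shift_v',
        Cochain.shift_v', Cochain.comp_v _ _ h (a + 1) (a + p + 1) (b + 1) (by omega) (by omega)]
      rfl)
    (fun x y n f => by
      change δ n (n + 1) (n.negOnePow • (M.act f).shift 1) =
        (n + 1).negOnePow • (M.act ((T.Hom y x).d n (n + 1) f)).shift 1
      rw [δ_units_smul, Cochain.δ_shift, negOnePow_smul_smul, M.act_d])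

/-- The homotopy cofiber of a morphism of modules: the pointwise mapping cone, whose degree `n`
part at `x` is `M(x)^(n+1) ⊕ N(x)^n`. A morphism `f` acts by `(-1) ^ |f|` times its action on `M`
on the first summand, and by its action on `N` on the second one. -/
noncomputable def cofiber {M N : DGModule T} (φ : M ⟶ N) : DGModule T :=
  ofAct (fun x => CochainComplex.mappingCone (Hom.app φ x))
    (fun x y n =>
      { toFun := fun f =>
          n.negOnePow • ((CochainComplex.mappingCone.fst (Hom.app φ x)).1.comp
            ((M.act f).comp (CochainComplex.mappingCone.inl (Hom.app φ y)) rfl)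
              (show 1 + (n + -1) = n by omega)) +
          (CochainComplex.mappingCone.snd (Hom.app φ x)).comp
            ((N.act f).comp (Cochain.ofHom (CochainComplex.mappingCone.inr (Hom.app φ y)))
              (add_zero n)) (zero_add n)
        map_add' := fun f g => by
          simp only [act_add, Cochain.add_comp, Cochain.comp_add, smul_add]
          abel
        map_smul' := fun r f => by
          simp only [act_smul, Cochain.smul_comp, Cochain.comp_smul, RingHom.id_apply, smul_add]
          congr 1
          rw [Units.smul_def, Units.smul_def]
          exact smul_comm _ _ _ })
    (fun x => by
      simp only [LinearMap.coe_mk, AddHom.coe_mk, act_one, Int.negOnePow_zero, one_smul]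
      rw [← CochainComplex.mappingCone.id]
      simp)
    (fun {x y z p q n} h h' f g => by
      have hM := M.act_comp h h' f g
      have hN := N.act_comp h h' f g
      simp only [LinearMap.coe_mk, AddHom.coe_mk, Cochain.add_comp, Cochain.comp_add,
        Cochain.units_smul_comp, Cochain.comp_units_smul]
      have e₁ : ((CochainComplex.mappingCone.fst (Hom.app φ x)).1.comp ((M.act f).comp
          (CochainComplex.mappingCone.inl (Hom.app φ y)) rfl) (show 1 + (p + -1) = p by omega)).comp
          ((CochainComplex.mappingCone.fst (Hom.app φ y)).1.comp ((M.act g).comp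
            (CochainComplex.mappingCone.inl (Hom.app φ z)) rfl)
              (show 1 + (q + -1) = q by omega)) h =
          (CochainComplex.mappingCone.fst (Hom.app φ x)).1.comp (((M.act f).comp (M.act g) h).comp
            (CochainComplex.mappingCone.inl (Hom.app φ z)) rfl)
              (show 1 + (n + -1) = n by omega) := by
        rw [Cochain.comp_assoc _ _ _ _ (show p + -1 + q = n - 1 by omega) (by omega),
          Cochain.comp_assoc _ _ _ _ (show -1 + q = q - 1 by omega) (by omega),
          CochainComplex.mappingCone.inl_fst_assoc,
          Cochain.comp_assoc (M.act f) _ _ h (show q + -1 = q + -1 by rfl) (by omega)]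
      have e₂ : ((CochainComplex.mappingCone.snd (Hom.app φ x)).comp ((N.act f).comp
          (Cochain.ofHom (CochainComplex.mappingCone.inr (Hom.app φ y))) (add_zero p))
            (zero_add p)).comp
          ((CochainComplex.mappingCone.fst (Hom.app φ y)).1.comp ((M.act g).comp
            (CochainComplex.mappingCone.inl (Hom.app φ z)) rfl)
              (show 1 + (q + -1) = q by omega)) h = 0 := by
        simp
      have e₃ : ((CochainComplex.mappingCone.fst (Hom.app φ x)).1.comp ((M.act f).comp
          (CochainComplex.mappingCone.inl (Hom.app φ y)) rfl) (show 1 + (p + -1) = p by omega)).comp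
          ((CochainComplex.mappingCone.snd (Hom.app φ y)).comp ((N.act g).comp
            (Cochain.ofHom (CochainComplex.mappingCone.inr (Hom.app φ z))) (add_zero q))
              (zero_add q)) h = 0 := by
        rw [Cochain.comp_assoc _ _ _ _ (show p + -1 + q = n - 1 by omega) (by omega),
          Cochain.comp_assoc _ _ _ _ (show -1 + q = q - 1 by omega) (by omega),
          CochainComplex.mappingCone.inl_snd_assoc, Cochain.comp_zero, Cochain.comp_zero]
      have e₄ : ((CochainComplex.mappingCone.snd (Hom.app φ x)).comp ((N.act f).comp
          (Cochain.ofHom (CochainComplex.mappingCone.inr (Hom.app φ y))) (add_zero p))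
            (zero_add p)).comp
          ((CochainComplex.mappingCone.snd (Hom.app φ y)).comp ((N.act g).comp
            (Cochain.ofHom (CochainComplex.mappingCone.inr (Hom.app φ z))) (add_zero q))
              (zero_add q)) h =
          (CochainComplex.mappingCone.snd (Hom.app φ x)).comp (((N.act f).comp (N.act g) h).comp
            (Cochain.ofHom (CochainComplex.mappingCone.inr (Hom.app φ z))) (add_zero n))
              (zero_add n) := by
        simp
      rw [e₁, e₂, e₃, e₄, ← hM, ← hN]
      simp only [Cochain.units_smul_comp, Cochain.comp_units_smul, smul_zero, add_zero, zero_add,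
        smul_add, negOnePow_smul_smul]
      congr 1
      exact negOnePow_smul_congr ⟨0, by subst h; ring⟩ _)
    (fun x y n f => by
      have hM := M.act_d f
      have hN := N.act_d f
      have hφ := Hom.naturality φ f
      simp only [LinearMap.coe_mk, AddHom.coe_mk, δ_add, δ_units_smul]
      rw [← hM, ← hN]
      rw [δ_comp _ _ (show 1 + (n + -1) = n by omega) 2 n (n + 1) rfl rfl (by omega),
        δ_comp _ _ (show n + -1 = n + -1 by rfl) (n + 1) 0 n (by omega) rfl rfl,
        δ_comp _ _ (zero_add n) 1 (n + 1) (n + 1) rfl rfl rfl,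
        CochainComplex.mappingCone.δ_inl, CochainComplex.mappingCone.δ_snd]
      simp
      rw [← Cochain.comp_assoc_of_second_is_zero_cochain (M.act f), hφ,
        Cochain.comp_assoc_of_first_is_zero_cochain, Int.negOnePow_succ, Units.neg_smul]
      have key : ∀ {G : Type u} [AddCommGroup G] (a b c : G), a + -b + (c + -a) = -b + c := by
        intro G _ a b c
        abel
      exact key _ _ _)

end DGModule

/-- A dg category `T` is pretriangulated if it has an object representing the zero module up to
weak equivalence, and if the modules that are weakly equivalent to representable ones are stable
under desuspension and under homotopy cofibers. -/
structure DGCat.IsPretriangulated (T : DGCat.{w} k) : Prop where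
  exists_zero : ∃ o : T.Ob, (DGModule.representable o).WeaklyEquivalent (DGModule.zero T)
  desuspension : ∀ (M : DGModule T) (c : T.Ob),
    M.suspension.WeaklyEquivalent (DGModule.representable c) →
      ∃ d : T.Ob, M.WeaklyEquivalent (DGModule.representable d)
  cofiber : ∀ (M N : DGModule T) (a b : T.Ob),
    M.WeaklyEquivalent (DGModule.representable a) →
      N.WeaklyEquivalent (DGModule.representable b) →
        ∀ φ : M ⟶ N, ∃ c : T.Ob,
          (DGModule.cofiber φ).WeaklyEquivalent (DGModule.representable c)

variable (k) in
/-- A cochain complex of `k`-vector spaces whose underlying sets are subsets of a fixed set `S`,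
that is, elements of the power set of `S`. -/
structure BoundedComplex (S : Type u) where
  /-- the underlying sets -/
  carrier : ℤ → Set S
  /-- the additive structures -/
  [addCommGroup : ∀ n, AddCommGroup (carrier n)]
  /-- the scalar multiplications -/
  [module : ∀ n, Module k (carrier n)]
  /-- the differential -/
  d : ∀ n, carrier n →ₗ[k] carrier (n + 1)
  d_comp_d : ∀ n, (d (n + 1)).comp (d n) = 0

attribute [instance] BoundedComplex.addCommGroup BoundedComplex.module

/-- The cochain complex of `k`-vector spaces given by a bounded complex. -/
def BoundedComplex.toComplex {S : Type u} (K : BoundedComplex k S) :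
    CochainComplex (ModuleCat.{u} k) ℤ :=
  CochainComplex.of (fun n => ModuleCat.of k (K.carrier n)) (fun n => ModuleCat.ofHom (K.d n))
    (fun n => ModuleCat.hom_ext (K.d_comp_d n))

/-- The small dg category of the modules over a small dg category `T` that take values in complexes
whose underlying sets are subsets of `S`. -/
def DGCat.boundedModules (T : DGCat.{u} k) (S : Type u) : DGCat.{u} k :=
  DGCat.functors T.op ((DGCat.ch k).full (BoundedComplex.toComplex (k := k) (S := S)))

/-- The module underlying a bounded module. -/
def DGCat.boundedModules.toModule {T : DGCat.{u} k} {S : Type u}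
    (M : (T.boundedModules S).Ob) : DGModule T :=
  DGFunctor.comp M ((DGCat.ch k).incl BoundedComplex.toComplex)

/-- The small dg category of the modules over `T` that are cofibrant and fibrant and take values in
complexes whose underlying sets are subsets of `S`: a full dg subcategory of
`T.boundedModules S`. -/
def DGCat.boundedCofibrantFibrantModules (T : DGCat.{u} k) (S : Type u) : DGCat.{u} k :=
  (T.boundedModules S).full
    (fun M : { M : (T.boundedModules S).Ob //
      (DGCat.boundedModules.toModule M).IsCofibrant ∧
        (DGCat.boundedModules.toModule M).IsFibrant } => M.1)

end

/-!
The given dg category `T` embeds into its modules by the Yoneda lemma, and representable modules are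
cofibrant. The point is that the cofibrant modules of bounded size form a pretriangulated dg
category, and that being pretriangulated, a condition about arbitrary modules up to zigzags of weak
equivalences, can be checked on strict constructions.

*A criterion.* A module `M` is weakly equivalent to the module represented by `a` if and only if
some closed element `z` of `M(a)` of degree `0` generates it, that is, if `g ↦ g z` is a
quasi-isomorphism `T(x, a) ⟶ M(x)` for all `x` (`weaklyEquivalent_representable_iff`): such elements
can be transported along weak equivalences in both directions, since quasi-isomorphisms can be
handled by elements (`CochainComplex.quasiIso_iff_elements`). It follows that a dg category with an
object whose identity is zero, with an object `d` and an isomorphism `d ⟶ c` of degree `-1` for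
every object `c` (`DGCat.IsoOfDegree`), and with a cone for every closed morphism of degree `0`
(`DGCat.ConeData`, a graded splitting with twisted differential) is pretriangulated
(`DGCat.isPretriangulated_of_exists`). For cones this is an elementwise five lemma
(`DGModule.Generates.cofiber`).

*Cofibrant modules.* In the dg category of all modules, shifts and mapping cones provide such
isomorphisms and cones (`DGModule.shiftIso`, `DGModule.cofiberConeData`). To see that cofibrant
modules are stable under them, cofibrancy is characterized by dg projectivity
(`DGModule.IsDGProjective`): dg natural transformations of any degree lift along pointwise
surjections, and the complexes of dg natural transformations to acyclic modules are acyclic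
(`IsCofibrant.isDGProjective`, `IsDGProjective.isCofibrant`). This property is visibly inherited by
isomorphic modules in the sense of `DGCat.IsoOfDegree` and by cones, and it holds for representable
modules by the Yoneda lemma. All modules are fibrant.

*Size.* A module whose values embed into `S` is isomorphic to one whose values have subsets of `S`
as underlying sets (`DGModule.exists_bounded_iso`), and conjugation by isomorphisms turns dg
functors to modules into dg functors to the full dg subcategory of bounded ones
(`DGFunctor.transport`). Since `#S * #S = #S` for infinite `S`, mapping cones remain bounded, so
`κ` can be any infinite cardinal that bounds the complexes of morphisms of `T`.
-/

/-! ### Quasi-isomorphisms by elements -/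

section QuasiIso

variable {k : Type u} [Field k] {K L : CochainComplex (ModuleCat.{u} k) ℤ}

lemma CochainComplex.exists_cycles_eq (K : CochainComplex (ModuleCat.{u} k) ℤ) {n : ℤ} (x : K.X n)
    (hx : K.d n (n + 1) x = 0) : ∃ z : K.cycles n, K.iCycles n z = x := by
  let x' : ModuleCat.of k k ⟶ K.X n := ModuleCat.ofHom (LinearMap.toSpanSingleton k (K.X n) x)
  have hx' : x' ≫ K.d n (n + 1) = 0 := by
    refine ModuleCat.hom_ext (LinearMap.ext_ring ?_)
    change K.d n (n + 1) ((1 : k) • x) = 0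
    rw [one_smul, hx]
  refine ⟨K.liftCycles x' (n + 1) (by simp) hx' (1 : k), ?_⟩
  exact (ConcreteCategory.congr_hom (K.liftCycles_i x' (n + 1) (by simp) hx') (1 : k)).trans
    (one_smul k x)

/-- A cycle is zero in homology if and only if it is a boundary. -/
lemma CochainComplex.homologyπ_eq_zero_iff (K : CochainComplex (ModuleCat.{u} k) ℤ) {m n : ℤ}
    (h : m + 1 = n) (z : K.cycles n) :
    K.homologyπ n z = 0 ↔ ∃ w : K.X m, K.iCycles n z = K.d m n w := by
  constructor
  · intro hz
    let z' : ModuleCat.of k k ⟶ K.cycles n :=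
      ModuleCat.ofHom (LinearMap.toSpanSingleton k (K.cycles n) z)
    have hz' : z' ≫ K.homologyπ n = 0 := by
      refine ModuleCat.hom_ext (LinearMap.ext_ring ?_)
      change K.homologyπ n ((1 : k) • z) = 0
      rw [one_smul, hz]
    obtain ⟨A, π, hπ, w, hw⟩ :=
      (K.comp_homologyπ_eq_zero_iff_up_to_refinements m n (by simp [← h]) z').1 hz'
    obtain ⟨a, ha⟩ := (ModuleCat.epi_iff_surjective π).1 hπ (1 : k)
    refine ⟨w a, ?_⟩
    have h₁ : K.iCycles n (π a • z) = K.iCycles n (K.toCycles m n (w a)) :=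
      ConcreteCategory.congr_hom (congrArg (· ≫ K.iCycles n) hw) a
    rw [ha, one_smul] at h₁
    exact h₁.trans (ConcreteCategory.congr_hom (K.toCycles_i m n) (w a))
  · rintro ⟨w, hw⟩
    have hz : z = K.toCycles m n w := by
      apply (ModuleCat.mono_iff_injective (K.iCycles n)).1 inferInstance
      rw [hw]
      exact (ConcreteCategory.congr_hom (K.toCycles_i m n) w).symm
    rw [hz]
    exact ConcreteCategory.congr_hom (K.toCycles_comp_homologyπ m n) w

lemma CochainComplex.d_iCycles_apply (K : CochainComplex (ModuleCat.{u} k) ℤ) {n : ℤ}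
    (z : K.cycles n) (m : ℤ) : K.d n m (K.iCycles n z) = 0 :=
  ConcreteCategory.congr_hom (K.iCycles_d n m) z

/-- The description of quasi-isomorphisms by elements. -/
lemma CochainComplex.quasiIso_iff_elements (f : K ⟶ L) :
    QuasiIso f ↔ ∀ m n : ℤ, m + 1 = n →
      (∀ y : L.X n, L.d n (n + 1) y = 0 →
        ∃ x : K.X n, K.d n (n + 1) x = 0 ∧ ∃ w : L.X m, y = f.f n x + L.d m n w) ∧
      (∀ x : K.X n, K.d n (n + 1) x = 0 → ∀ w : L.X m, f.f n x = L.d m n w →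
        ∃ v : K.X m, x = K.d m n v) := by
  have hπ (n : ℤ) (z : K.cycles n) : HomologicalComplex.homologyMap f n (K.homologyπ n z) =
      L.homologyπ n (HomologicalComplex.cyclesMap f n z) :=
    ConcreteCategory.congr_hom (HomologicalComplex.homologyπ_naturality f n) z
  have hi (n : ℤ) (z : K.cycles n) : L.iCycles n (HomologicalComplex.cyclesMap f n z) =
      f.f n (K.iCycles n z) :=
    ConcreteCategory.congr_hom (HomologicalComplex.cyclesMap_i f n) z
  have surjπ (M : CochainComplex (ModuleCat.{u} k) ℤ) (n : ℤ) :
      Function.Surjective (M.homologyπ n) := (ModuleCat.epi_iff_surjective _).1 inferInstance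
  rw [quasiIso_iff]
  simp only [quasiIsoAt_iff_isIso_homologyMap]
  constructor
  · intro hf m n h
    have hb : Function.Bijective (HomologicalComplex.homologyMap f n) :=
      (ConcreteCategory.isIso_iff_bijective _).1 (hf n)
    refine ⟨fun y hy => ?_, fun x hx w hw => ?_⟩
    · obtain ⟨z, rfl⟩ := L.exists_cycles_eq y hy
      obtain ⟨t, ht⟩ := hb.2 (L.homologyπ n z)
      obtain ⟨t, rfl⟩ := surjπ K n t
      rw [hπ, ← sub_eq_zero, ← map_sub] at ht
      obtain ⟨w, hw⟩ := (L.homologyπ_eq_zero_iff h _).1 ht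
      rw [map_sub, hi] at hw
      refine ⟨K.iCycles n t, K.d_iCycles_apply t _, -w, ?_⟩
      rw [map_neg, ← hw]
      abel
    · obtain ⟨z, rfl⟩ := K.exists_cycles_eq x hx
      rw [← K.homologyπ_eq_zero_iff h]
      apply hb.1
      rw [hπ, map_zero, L.homologyπ_eq_zero_iff h]
      exact ⟨w, (hi n z).trans hw⟩
  · intro hf n
    obtain ⟨h₁, h₂⟩ := hf (n - 1) n (by omega)
    refine (ConcreteCategory.isIso_iff_bijective _).2 ⟨?_, fun y => ?_⟩
    · rw [injective_iff_map_eq_zero]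
      intro x hx
      obtain ⟨z, rfl⟩ := surjπ K n x
      rw [hπ, L.homologyπ_eq_zero_iff (show n - 1 + 1 = n by omega)] at hx
      obtain ⟨w, hw⟩ := hx
      rw [K.homologyπ_eq_zero_iff (show n - 1 + 1 = n by omega)]
      exact h₂ _ (K.d_iCycles_apply z _) w ((hi n z).symm.trans hw)
    · obtain ⟨z, rfl⟩ := surjπ L n y
      obtain ⟨x, hx, w, hw⟩ := h₁ _ (L.d_iCycles_apply z _)
      obtain ⟨t, rfl⟩ := K.exists_cycles_eq x hx
      refine ⟨K.homologyπ n t, ?_⟩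
      rw [hπ, ← sub_eq_zero, ← map_sub, L.homologyπ_eq_zero_iff (show n - 1 + 1 = n by omega)]
      refine ⟨-w, ?_⟩
      rw [map_sub, hi, hw, map_neg]
      abel

lemma CochainComplex.d_d_apply (K : CochainComplex (ModuleCat.{u} k) ℤ) (l m n : ℤ) (x : K.X l) :
    K.d m n (K.d l m x) = 0 :=
  ConcreteCategory.congr_hom (K.d_comp_d l m n) x

lemma CochainComplex.f_d_apply (f : K ⟶ L) (m n : ℤ) (x : K.X m) :
    f.f n (K.d m n x) = L.d m n (f.f m x) :=
  (ConcreteCategory.congr_hom (f.comm m n) x).symm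

lemma CochainComplex.quasiIso_of_bijective (f : K ⟶ L)
    (hf : ∀ n, Function.Bijective (f.f n)) : QuasiIso f := by
  rw [CochainComplex.quasiIso_iff_elements]
  refine fun m n h => ⟨fun y hy => ?_, fun x _ w hw => ?_⟩
  · obtain ⟨x, rfl⟩ := (hf n).2 y
    rw [← CochainComplex.f_d_apply] at hy
    exact ⟨x, (hf (n + 1)).1 (hy.trans (map_zero _).symm), 0, by simp⟩
  · obtain ⟨v, rfl⟩ := (hf m).2 w
    rw [← CochainComplex.f_d_apply] at hw
    exact ⟨v, (hf n).1 hw⟩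

end QuasiIso

/-! ### Isomorphisms of arbitrary degree and cones in a dg category -/

section Elements

variable {k : Type u} [Field k]

lemma ModuleCat.hom_negOnePow_smul {M N : ModuleCat.{u} k} (φ : M ⟶ N) (a : ℤ) (x : M) :
    φ (a.negOnePow • x) = a.negOnePow • φ x :=
  map_negOnePow_smul φ.hom a x

namespace DGCat

variable (D : DGCat.{w} k)

/-- The Leibniz rule, with free indices. -/
lemma d_comp' {x y z : D.Ob} {p q n p' q' n' : ℤ} (h : p + q = n) (hp : p + 1 = p')
    (hq : q + 1 = q') (hn : n + 1 = n') (f : (D.Hom x y).X p) (g : (D.Hom y z).X q) :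
    (D.Hom x z).d n n' (D.comp h f g) =
      D.comp (show p + q' = n' by omega) f ((D.Hom y z).d q q' g) +
        q.negOnePow • D.comp (show p' + q = n' by omega) ((D.Hom x y).d p p' f) g := by
  subst hp hq hn
  exact D.d_comp h f g

lemma d_comp_of_d_eq_zero {x y z : D.Ob} {p q n p' q' n' : ℤ} (h : p + q = n) (hp : p + 1 = p')
    (hq : q + 1 = q') (hn : n + 1 = n') {f : (D.Hom x y).X p} (hf : (D.Hom x y).d p p' f = 0)
    (g : (D.Hom y z).X q) :
    (D.Hom x z).d n n' (D.comp h f g) =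
      D.comp (show p + q' = n' by omega) f ((D.Hom y z).d q q' g) := by
  rw [D.d_comp' h hp hq hn, hf, map_zero, LinearMap.zero_apply, smul_zero, add_zero]

lemma d_comp_of_d_eq_zero' {x y z : D.Ob} {p q n p' q' n' : ℤ} (h : p + q = n) (hp : p + 1 = p')
    (hq : q + 1 = q') (hn : n + 1 = n') (f : (D.Hom x y).X p)
    {g : (D.Hom y z).X q} (hg : (D.Hom y z).d q q' g = 0) :
    (D.Hom x z).d n n' (D.comp h f g) =
      q.negOnePow • D.comp (show p' + q = n' by omega) ((D.Hom x y).d p p' f) g := by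
  rw [D.d_comp' h hp hq hn, hg, map_zero, zero_add]

/-- An isomorphism of degree `n` in a dg category, that is, an invertible closed morphism. For
`n = -1` it exhibits `x` as a desuspension of `y`. -/
structure IsoOfDegree (x y : D.Ob) (n : ℤ) where
  /-- the closed morphism -/
  hom : (D.Hom x y).X n
  /-- its inverse -/
  inv : (D.Hom y x).X (-n)
  d_hom : (D.Hom x y).d n (n + 1) hom = 0
  d_inv : (D.Hom y x).d (-n) (-n + 1) inv = 0
  hom_inv_id : D.comp (add_neg_cancel n) hom inv = D.one x
  inv_hom_id : D.comp (neg_add_cancel n) inv hom = D.one y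

/-- The structure of a cone of a morphism `f` of degree `0` on an object `c` of a dg category: a
decomposition of `c` as the graded direct sum of the suspension of `a` and of `b`, in which the
differential is twisted by `f`. -/
structure ConeData {a b : D.Ob} (f : (D.Hom a b).X 0) (c : D.Ob) where
  /-- the inclusion of the first summand -/
  inl : (D.Hom a c).X (-1)
  /-- the inclusion of the second summand -/
  inr : (D.Hom b c).X 0
  /-- the first projection -/
  fst : (D.Hom c a).X 1
  /-- the second projection -/
  snd : (D.Hom c b).X 0
  d_inl : (D.Hom a c).d (-1) 0 inl = D.comp (add_zero 0) f inr
  d_inr : (D.Hom b c).d 0 1 inr = 0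
  d_fst : (D.Hom c a).d 1 2 fst = 0
  d_snd : (D.Hom c b).d 0 1 snd = -D.comp (add_zero 1) fst f
  inl_fst : D.comp (neg_add_cancel 1) inl fst = D.one a
  inl_snd : D.comp (add_zero (-1)) inl snd = 0
  inr_fst : D.comp (zero_add 1) inr fst = 0
  inr_snd : D.comp (add_zero 0) inr snd = D.one b
  fst_inl_add_snd_inr :
    D.comp (add_neg_cancel 1) fst inl + D.comp (add_zero 0) snd inr = D.one c

end DGCat

/-! ### Elements of modules that generate them up to weak equivalence -/

namespace DGModule

variable {T : DGCat.{w} k}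

/-- The action of morphisms on the elements of a module. The element is written last, although the
action is a right one, so that `smul_smul'` and `eval_smul` involve Koszul signs. -/
def smul (M : DGModule T) {x y : T.Ob} {n p q : ℤ} (h : p + n = q) :
    (T.Hom y x).X n →ₗ[k] (M.cx x).X p →ₗ[k] (M.cx y).X q :=
  LinearMap.mk₂ k (fun f z => (M.act f).v p q h z)
    (fun f g z => by rw [act_add]; rfl) (fun c f z => by rw [act_smul]; rfl)
    (fun f z z' => map_add _ z z') (fun c f z => map_smul ((M.act f).v p q h).hom c z)

lemma smul_apply (M : DGModule T) {x y : T.Ob} {n p q : ℤ} (h : p + n = q) (f : (T.Hom y x).X n)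
    (z : (M.cx x).X p) : M.smul h f z = (M.act f).v p q h z := rfl

lemma one_smul' (M : DGModule T) {x : T.Ob} {p : ℤ} (z : (M.cx x).X p) :
    M.smul (add_zero p) (T.one x) z = z := by
  rw [smul_apply, act_one, Cochain.ofHom_v]
  rfl

lemma smul_smul' (M : DGModule T) {x y t : T.Ob} {m n mn p q r : ℤ} (hm : p + m = q)
    (hn : q + n = r) (h : n + m = mn) (h' : p + mn = r) (f : (T.Hom y x).X m)
    (g : (T.Hom t y).X n) (z : (M.cx x).X p) :
    M.smul hn g (M.smul hm f z) = (m * n).negOnePow • M.smul h' (T.comp h g f) z := by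
  have h₁ := Cochain.congr_v (M.act_comp (show m + n = mn by omega) h f g) p r h'
  rw [Cochain.comp_v _ _ _ p q r hm hn] at h₁
  exact (ConcreteCategory.congr_hom h₁ z).symm

lemma d_smul (M : DGModule T) {x y : T.Ob} {n p q n' p' q' : ℤ} (h : p + n = q)
    (hn : n + 1 = n') (hp : p + 1 = p') (hq : q + 1 = q') (f : (T.Hom y x).X n)
    (z : (M.cx x).X p) :
    (M.cx y).d q q' (M.smul h f z) =
      M.smul (show p + n' = q' by omega) ((T.Hom y x).d n n' f) z +
        n.negOnePow • M.smul (show p' + n = q' by omega) f ((M.cx x).d p p' z) := by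
  subst hn
  have h₁ := Cochain.congr_v (M.act_d f) p q' (by omega)
  rw [δ_v n (n + 1) rfl _ p q' _ q p' (by omega) hp] at h₁
  have h₂ : (M.cx y).d q q' (M.smul h f z) +
      (n + 1).negOnePow • M.smul (show p' + n = q' by omega) f ((M.cx x).d p p' z) =
      M.smul (show p + (n + 1) = q' by omega) ((T.Hom y x).d n (n + 1) f) z :=
    ConcreteCategory.congr_hom h₁ z
  rw [← h₂, Int.negOnePow_succ, Units.neg_smul]
  abel

lemma Hom.app_smul {M N : DGModule T} (φ : M ⟶ N) {x y : T.Ob} {n p q : ℤ} (h : p + n = q)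
    (f : (T.Hom y x).X n) (z : (M.cx x).X p) :
    (Hom.app φ y).f q (M.smul h f z) = N.smul h f ((Hom.app φ x).f p z) := by
  have h₁ := Cochain.congr_v (Hom.naturality φ f) p q h
  rw [Cochain.comp_zero_cochain_v, Cochain.zero_cochain_comp_v, Cochain.ofHom_v,
    Cochain.ofHom_v] at h₁
  exact ConcreteCategory.congr_hom h₁ z

lemma representable_smul (c : T.Ob) {x y : T.Ob} {n p q : ℤ} (h : p + n = q)
    (f : (T.Hom y x).X n) (z : (T.Hom x c).X p) :
    (representable c).smul h f z =
      (n * p).negOnePow • T.comp (show n + p = q by omega) f z := rfl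

/-- The morphism of modules corresponding to a closed element of degree `0` by the Yoneda lemma. -/
def yonedaHom (M : DGModule T) {a : T.Ob} (z : (M.cx a).X 0) (hz : (M.cx a).d 0 1 z = 0) :
    representable a ⟶ M where
  app x :=
    { f := fun n => ModuleCat.ofHom ((M.smul (zero_add n)).flip z)
      comm' := fun n n' h => by
        refine ModuleCat.hom_ext (LinearMap.ext fun (g : (T.Hom x a).X n) => ?_)
        change (M.cx x).d n n' (M.smul (zero_add n) g z) =
          M.smul (zero_add n') ((T.Hom x a).d n n' g) z
        rw [M.d_smul (zero_add n) h (zero_add 1) h, hz, map_zero, smul_zero, add_zero] }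
  naturality {x y n} f := by
    ext p q h : 1
    rw [Cochain.comp_zero_cochain_v, Cochain.zero_cochain_comp_v, Cochain.ofHom_v,
      Cochain.ofHom_v]
    refine ModuleCat.hom_ext (LinearMap.ext fun (e : (T.Hom x a).X p) => ?_)
    change M.smul (zero_add q) ((n * p).negOnePow • T.comp (show n + p = q by omega) f e) z =
      M.smul h f (M.smul (zero_add p) e z)
    rw [M.smul_smul' (zero_add p) h (show n + p = q by omega) (by omega),
      map_negOnePow_smul₂]
    exact negOnePow_smul_congr ⟨0, by ring⟩ _

/-- A closed element `z` of degree `0` of `M(a)` generates the module `M` if the morphism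
`g ↦ g z` from the module represented by `a` is a weak equivalence; spelled out in elements. -/
structure Generates (M : DGModule T) {a : T.Ob} (z : (M.cx a).X 0) : Prop where
  d_eq_zero : (M.cx a).d 0 1 z = 0
  surj : ∀ (x : T.Ob) (m n : ℤ), m + 1 = n → ∀ y : (M.cx x).X n, (M.cx x).d n (n + 1) y = 0 →
    ∃ g : (T.Hom x a).X n, (T.Hom x a).d n (n + 1) g = 0 ∧
      ∃ w : (M.cx x).X m, y = M.smul (zero_add n) g z + (M.cx x).d m n w
  inj : ∀ (x : T.Ob) (m n : ℤ), m + 1 = n → ∀ g : (T.Hom x a).X n,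
    (T.Hom x a).d n (n + 1) g = 0 → ∀ w : (M.cx x).X m,
      M.smul (zero_add n) g z = (M.cx x).d m n w → ∃ v : (T.Hom x a).X m, g = (T.Hom x a).d m n v

lemma Generates.isWeakEquiv {M : DGModule T} {a : T.Ob} {z : (M.cx a).X 0} (hz : M.Generates z) :
    IsWeakEquiv (M.yonedaHom z hz.d_eq_zero) := fun x =>
  (CochainComplex.quasiIso_iff_elements _).2 fun m n h => ⟨hz.surj x m n h, hz.inj x m n h⟩

lemma Generates.weaklyEquivalent {M : DGModule T} {a : T.Ob} {z : (M.cx a).X 0}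
    (hz : M.Generates z) : M.WeaklyEquivalent (representable a) :=
  .symm _ _ (.rel _ _ ⟨_, hz.isWeakEquiv⟩)

lemma generates_one (a : T.Ob) : (representable a).Generates (a := a) (T.one a) := by
  have h (x : T.Ob) (n : ℤ) (g : (T.Hom x a).X n) :
      (representable a).smul (zero_add n) g (T.one a) = g := by
    rw [representable_smul, mul_zero, Int.negOnePow_zero, one_smul]
    exact T.comp_one g
  refine ⟨T.d_one a, fun x m n hm y hy => ⟨y, hy, 0, ?_⟩,
    fun x m n hm g hg w hw => ⟨w, (h x n g).symm.trans hw⟩⟩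
  have h₀ : y = (representable a).smul (zero_add n) y (T.one a) := (h x n y).symm
  exact h₀.trans ((congrArg _ (map_zero _)).trans (add_zero _)).symm

/-- Generators are preserved by weak equivalences. -/
lemma Generates.app {M N : DGModule T} {φ : M ⟶ N} (hφ : IsWeakEquiv φ) {a : T.Ob}
    {z : (M.cx a).X 0} (hz : M.Generates z) : N.Generates ((Hom.app φ a).f 0 z) := by
  have hd : (N.cx a).d 0 1 ((Hom.app φ a).f 0 z) = 0 := by
    rw [← CochainComplex.f_d_apply, hz.d_eq_zero, map_zero]
  refine ⟨hd, fun x m n h y hy => ?_, fun x m n h g hg w hw => ?_⟩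
  · obtain ⟨h₁, -⟩ := (CochainComplex.quasiIso_iff_elements _).1 (hφ x) m n h
    obtain ⟨y', hy', w, rfl⟩ := h₁ y hy
    obtain ⟨g, hg, v, rfl⟩ := hz.surj x m n h y' hy'
    refine ⟨g, hg, (Hom.app φ x).f m v + w, ?_⟩
    rw [map_add, map_add, Hom.app_smul, CochainComplex.f_d_apply, add_assoc]
  · obtain ⟨-, h₂⟩ := (CochainComplex.quasiIso_iff_elements _).1 (hφ x) m n h
    rw [← Hom.app_smul] at hw
    obtain ⟨v, hv⟩ := h₂ _ (by
      rw [M.d_smul (zero_add n) rfl (zero_add 1) rfl, hz.d_eq_zero, hg]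
      simp only [map_zero, LinearMap.zero_apply, smul_zero, add_zero]) w hw
    exact hz.inj x m n h g hg v hv

/-- A generator `z` of the target of a weak equivalence `φ` lifts: `z = φ z' + d w` for a closed
element `z'`, which is a generator since `g z` and `φ (g z')` are cohomologous for all closed `g`.
-/
lemma Generates.exists_of_isWeakEquiv {M N : DGModule T} {φ : M ⟶ N} (hφ : IsWeakEquiv φ)
    {a : T.Ob} {z : (N.cx a).X 0} (hz : N.Generates z) :
    ∃ z' : (M.cx a).X 0, M.Generates z' := by
  obtain ⟨z', hz', w, hw⟩ := ((CochainComplex.quasiIso_iff_elements _).1 (hφ a) (-1) 0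
    (by norm_num)).1 z hz.d_eq_zero
  have key (x : T.Ob) {m n : ℤ} (h : m + 1 = n) (g : (T.Hom x a).X n)
      (hg : (T.Hom x a).d n (n + 1) g = 0) : ∃ t : (N.cx x).X m, N.smul (zero_add n) g z =
        (Hom.app φ x).f n (M.smul (zero_add n) g z') + (N.cx x).d m n t := by
    refine ⟨n.negOnePow • N.smul (show -1 + n = m by omega) g w, ?_⟩
    rw [Hom.app_smul, hw, map_add, ModuleCat.hom_negOnePow_smul,
      N.d_smul (show -1 + n = m by omega) rfl (show -1 + 1 = 0 by norm_num) h, hg, map_zero,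
      LinearMap.zero_apply, zero_add, negOnePow_smul_smul,
      negOnePow_smul_congr (a := n + n) (b := 0) ⟨n, by ring⟩]
    simp
  have hd (x : T.Ob) {n : ℤ} (g : (T.Hom x a).X n)
      (hg : (T.Hom x a).d n (n + 1) g = 0) :
      (M.cx x).d n (n + 1) (M.smul (zero_add n) g z') = 0 := by
    rw [M.d_smul (zero_add n) rfl (zero_add 1) rfl, hg, map_zero, LinearMap.zero_apply, zero_add]
    exact (congrArg _ ((congrArg _ hz').trans (map_zero _))).trans (smul_zero _)
  refine ⟨z', hz', fun x m n h y hy => ?_, fun x m n h g hg v hv => ?_⟩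
  · obtain ⟨-, h₂⟩ := (CochainComplex.quasiIso_iff_elements _).1 (hφ x) m n h
    obtain ⟨g, hg, t, ht⟩ := hz.surj x m n h ((Hom.app φ x).f n y) (by
      rw [← CochainComplex.f_d_apply, hy, map_zero])
    obtain ⟨s, hs⟩ := key x h g hg
    obtain ⟨v, hv⟩ := h₂ (y - M.smul (zero_add n) g z') (by rw [map_sub, hy, hd x g hg, sub_zero])
      (t + s) (by rw [map_sub, ht, hs, map_add]; abel)
    exact ⟨g, hg, v, by rw [← hv]; abel⟩
  · obtain ⟨s, hs⟩ := key x h g hg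
    exact hz.inj x m n h g hg ((Hom.app φ x).f m v + s) (by
      rw [hs, hv, CochainComplex.f_d_apply, map_add])

/-- A module is weakly equivalent to a representable one if and only if it is generated by a closed
element: such elements can be transported along weak equivalences in both directions. -/
lemma weaklyEquivalent_representable_iff (M : DGModule T) (a : T.Ob) :
    M.WeaklyEquivalent (representable a) ↔ ∃ z : (M.cx a).X 0, M.Generates z := by
  refine ⟨fun h => ?_, fun ⟨z, hz⟩ => hz.weaklyEquivalent⟩
  have aux {P Q : DGModule T} (h : P.WeaklyEquivalent Q) :
      (∃ z : (P.cx a).X 0, P.Generates z) ↔ (∃ z : (Q.cx a).X 0, Q.Generates z) := by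
    induction h with
    | rel P Q h =>
      obtain ⟨φ, hφ⟩ := h
      exact ⟨fun ⟨z, hz⟩ => ⟨_, hz.app hφ⟩, fun ⟨z, hz⟩ => hz.exists_of_isWeakEquiv hφ⟩
    | refl P => rfl
    | symm P Q _ ih => exact ih.symm
    | trans P Q R _ _ ih₁ ih₂ => exact ih₁.trans ih₂
  exact (aux h).2 ⟨_, generates_one a⟩

end DGModule

end Elements

/-! ### Generators of desuspensions -/

section Suspension

variable {k : Type u} [Field k]

namespace DGModule

variable {T : DGCat.{w} k}

/-- A generator of a suspension is a closed element `z` of degree `1` of the original module such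
that the morphisms `g ↦ g z` of degree `1` are quasi-isomorphisms. -/
lemma Generates.of_suspension {M : DGModule T} {c : T.Ob} {z : (M.cx c).X 1}
    (hz : M.suspension.Generates (a := c) z) :
    (M.cx c).d 1 2 z = 0 ∧ ∀ (x : T.Ob) (l m n : ℤ) (_ : l + 1 = m) (hm : m + 1 = n),
      (∀ y : (M.cx x).X n, (M.cx x).d n (n + 1) y = 0 →
        ∃ g : (T.Hom x c).X m, (T.Hom x c).d m (m + 1) g = 0 ∧
          ∃ w : (M.cx x).X m, y = M.smul (show 1 + m = n by omega) g z + (M.cx x).d m n w) ∧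
      (∀ g : (T.Hom x c).X m, (T.Hom x c).d m (m + 1) g = 0 → ∀ w : (M.cx x).X m,
        M.smul (show 1 + m = n by omega) g z = (M.cx x).d m n w →
          ∃ v : (T.Hom x c).X l, g = (T.Hom x c).d l m v) := by
  have hd (x : T.Ob) (p q : ℤ) (t : (M.cx x).X (p + 1)) :
      ((M.suspension.cx x).d p q t : (M.cx x).X (q + 1)) = -(M.cx x).d (p + 1) (q + 1) t := by
    have h : ((M.suspension.cx x).d p q t : (M.cx x).X (q + 1)) =
        (1 : ℤ).negOnePow • (M.cx x).d (p + 1) (q + 1) t := rfl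
    rw [h, Int.negOnePow_one, Units.neg_smul, one_smul]
  have hs (x : T.Ob) (m : ℤ) (g : (T.Hom x c).X m) :
      (M.suspension.smul (zero_add m) g z : (M.cx x).X (m + 1)) =
        m.negOnePow • M.smul (show 1 + m = m + 1 by omega) g z := rfl
  refine ⟨?_, ?_⟩
  · have h := (hd c 0 1 z).symm.trans hz.d_eq_zero
    exact neg_eq_zero.1 h
  · intro x l m n hl hm
    subst hl hm
    refine ⟨fun y hy => ?_, fun g hg w hw => ?_⟩
    · obtain ⟨g, hg, (w : (M.cx x).X (l + 1)), h⟩ := hz.surj x l (l + 1) rfl y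
        ((hd x (l + 1) (l + 1 + 1) y).trans (neg_eq_zero.2 hy))
      refine ⟨(l + 1).negOnePow • g, ?_, -w, ?_⟩
      · rw [ModuleCat.hom_negOnePow_smul, hg, smul_zero]
      · rw [map_negOnePow_smul₂, map_neg]
        exact h.trans (congrArg₂ (· + ·) (hs x (l + 1) g) (hd x l (l + 1) w))
    · refine hz.inj x l (l + 1) rfl g hg (-((l + 1).negOnePow • w) : (M.cx x).X (l + 1)) ?_
      refine (hs x (l + 1) g).trans ((?_ : _ = _).trans (hd x l (l + 1) _).symm)
      rw [hw, map_neg, ModuleCat.hom_negOnePow_smul, neg_neg]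

/-- A generator `z` of the suspension of `M`, at an object `c`, gives a generator of `M` at a
desuspension of `c`. -/
lemma Generates.desuspension {M : DGModule T} {c d : T.Ob} {z : (M.cx c).X 1}
    (hz : M.suspension.Generates (a := c) z) (e : T.IsoOfDegree d c (-1)) :
    M.Generates (M.smul (show (1 : ℤ) + -1 = 0 by norm_num) e.hom z) := by
  obtain ⟨hd, hz⟩ := hz.of_suspension
  have hσ : (T.Hom d c).d (-1) 0 e.hom = 0 := e.d_hom
  have hτ : (T.Hom c d).d 1 2 e.inv = 0 := e.d_inv
  refine ⟨?_, fun x m n h y hy => ?_, fun x m n h g hg w hw => ?_⟩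
  · rw [M.d_smul _ (show (-1 : ℤ) + 1 = 0 by norm_num) (show (1 : ℤ) + 1 = 2 by norm_num)
      (zero_add 1), hσ, hd]
    simp only [map_zero, LinearMap.zero_apply, smul_zero, add_zero]
  · obtain ⟨g, hg, w, rfl⟩ := (hz x (m - 1) m n (by omega) h).1 y hy
    refine ⟨n.negOnePow • T.comp (show m + 1 = n from h) g e.inv, ?_, w, ?_⟩
    · rw [ModuleCat.hom_negOnePow_smul, T.d_comp_of_d_eq_zero' h rfl (show (1 : ℤ) + 1 = 2 by
        norm_num) rfl g hτ]
      rw [hg, map_zero, LinearMap.zero_apply, smul_zero, smul_zero]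
    · rw [map_negOnePow_smul₂, M.smul_smul' _ (zero_add n) (show n + -1 = m by omega)
        (show 1 + m = n by omega), T.assoc h (show (1 : ℤ) + -1 = 0 by norm_num) (by omega)
          (add_zero m)]
      rw [show T.comp (show (1 : ℤ) + -1 = 0 by norm_num) e.inv e.hom = T.one c from e.inv_hom_id,
        T.comp_one, negOnePow_smul_smul, negOnePow_smul_congr (b := 0) ⟨0, by ring⟩]
      simp
  · rw [M.smul_smul' _ (zero_add n) (show n + -1 = m by omega) (show 1 + m = n by omega)] at hw
    obtain ⟨v, hv⟩ := (hz x (m - 1) m n (by omega) h).2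
      (T.comp (show n + -1 = m by omega) g e.hom) (by
        rw [T.d_comp_of_d_eq_zero (show n + -1 = m by omega) rfl (show (-1 : ℤ) + 1 = 0 by norm_num)
          rfl hg, hσ, map_zero]) ((-1 * n).negOnePow • w) (by
        rw [ModuleCat.hom_negOnePow_smul, ← hw, negOnePow_smul_smul,
          negOnePow_smul_congr (b := 0) ⟨-n, by ring⟩]
        simp)
    refine ⟨(1 : ℤ).negOnePow • T.comp (show m - 1 + 1 = m by omega) v e.inv, ?_⟩
    rw [ModuleCat.hom_negOnePow_smul, T.d_comp_of_d_eq_zero' (show m - 1 + 1 = m by omega)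
      (show m - 1 + 1 = m by omega) (show (1 : ℤ) + 1 = 2 by norm_num) h v hτ, ← hv,
      T.assoc (show n + -1 = m by omega) (show (-1 : ℤ) + 1 = 0 by norm_num) (by omega)
          (add_zero n), negOnePow_smul_smul, negOnePow_smul_congr (b := 0) ⟨1, by ring⟩,
      show T.comp (show (-1 : ℤ) + 1 = 0 by norm_num) e.hom e.inv = T.one d from e.hom_inv_id,
      T.comp_one]
    simp

end DGModule

end Suspension

/-! ### Elements of homotopy cofibers -/

section Cofiber

variable {k : Type u} [Field k]

namespace DGModule

variable {T : DGCat.{w} k} {M N : DGModule T} (φ : M ⟶ N)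

/-- The first projection `(cofiber φ)(x)^n ⟶ M(x)^(n+1)`. -/
noncomputable def cofiberFst (x : T.Ob) {n n' : ℤ} (h : n + 1 = n') :
    ((cofiber φ).cx x).X n →ₗ[k] (M.cx x).X n' :=
  ((CochainComplex.mappingCone.fst (Hom.app φ x)).1.v n n' h).hom

/-- The second projection `(cofiber φ)(x)^n ⟶ N(x)^n`. -/
noncomputable def cofiberSnd (x : T.Ob) (n : ℤ) :
    ((cofiber φ).cx x).X n →ₗ[k] (N.cx x).X n :=
  ((CochainComplex.mappingCone.snd (Hom.app φ x)).v n n (add_zero n)).hom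

lemma cofiber_exists (x : T.Ob) {n n' : ℤ} (h : n + 1 = n') (a : (M.cx x).X n')
    (b : (N.cx x).X n) :
    ∃ t : ((cofiber φ).cx x).X n, cofiberFst φ x h t = a ∧ cofiberSnd φ x n t = b := by
  let t₁ : ((cofiber φ).cx x).X n :=
    (CochainComplex.mappingCone.inl (Hom.app φ x)).v n' n (by omega) a
  let t₂ : ((cofiber φ).cx x).X n := (CochainComplex.mappingCone.inr (Hom.app φ x)).f n b
  have h₁₁ : cofiberFst φ x h t₁ = a := ConcreteCategory.congr_hom
    (CochainComplex.mappingCone.inl_v_fst_v (Hom.app φ x) n' n h) a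
  have h₁₂ : cofiberSnd φ x n t₁ = 0 := ConcreteCategory.congr_hom
    (CochainComplex.mappingCone.inl_v_snd_v (Hom.app φ x) n' n (by omega)) a
  have h₂₁ : cofiberFst φ x h t₂ = 0 := ConcreteCategory.congr_hom
    (CochainComplex.mappingCone.inr_f_fst_v (Hom.app φ x) n n' h) b
  have h₂₂ : cofiberSnd φ x n t₂ = b := ConcreteCategory.congr_hom
    (CochainComplex.mappingCone.inr_f_snd_v (Hom.app φ x) n) b
  exact ⟨t₁ + t₂, by rw [map_add, h₁₁, h₂₁, add_zero], by rw [map_add, h₁₂, h₂₂, zero_add]⟩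

variable {φ} in
lemma cofiber_ext {x : T.Ob} {n n' : ℤ} (h : n + 1 = n') {s t : ((cofiber φ).cx x).X n}
    (h₁ : cofiberFst φ x h s = cofiberFst φ x h t)
    (h₂ : cofiberSnd φ x n s = cofiberSnd φ x n t) : s = t := by
  have key (r : ((cofiber φ).cx x).X n) :
      (CochainComplex.mappingCone.inl (Hom.app φ x)).v n' n (by omega) (cofiberFst φ x h r) +
        (CochainComplex.mappingCone.inr (Hom.app φ x)).f n (cofiberSnd φ x n r) = r :=
    ConcreteCategory.congr_hom (CochainComplex.mappingCone.id_X (Hom.app φ x) n n' h) r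
  rw [← key s, h₁, h₂, key t]

lemma cofiberFst_d (x : T.Ob) {n n' n'' : ℤ} (h : n + 1 = n') (h' : n' + 1 = n'')
    (t : ((cofiber φ).cx x).X n) :
    cofiberFst φ x h' (((cofiber φ).cx x).d n n' t) = -(M.cx x).d n' n'' (cofiberFst φ x h t) :=
  ConcreteCategory.congr_hom (CochainComplex.mappingCone.d_fst_v (Hom.app φ x) n n' n'' h h') t

lemma cofiberSnd_d (x : T.Ob) {n n' : ℤ} (h : n + 1 = n') (t : ((cofiber φ).cx x).X n) :
    cofiberSnd φ x n' (((cofiber φ).cx x).d n n' t) =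
      (Hom.app φ x).f n' (cofiberFst φ x h t) + (N.cx x).d n n' (cofiberSnd φ x n t) :=
  ConcreteCategory.congr_hom (CochainComplex.mappingCone.d_snd_v (Hom.app φ x) n n' h) t

/-- The action on the cofiber, as a cochain between mapping cones. -/
noncomputable def cofiberAct {x y : T.Ob} {n : ℤ} (f : (T.Hom y x).X n) :
    Cochain (CochainComplex.mappingCone (Hom.app φ x))
      (CochainComplex.mappingCone (Hom.app φ y)) n :=
  (cofiber φ).act f

lemma cofiberAct_comp_fst {x y : T.Ob} {n m : ℤ} (h : n + 1 = m) (h' : 1 + n = m)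
    (f : (T.Hom y x).X n) :
    (cofiberAct φ f).comp (CochainComplex.mappingCone.fst (Hom.app φ y)).1 h =
      n.negOnePow • (CochainComplex.mappingCone.fst (Hom.app φ x)).1.comp (M.act f) h' := by
  change (n.negOnePow • ((CochainComplex.mappingCone.fst (Hom.app φ x)).1.comp
            ((M.act f).comp (CochainComplex.mappingCone.inl (Hom.app φ y)) rfl)
              (show 1 + (n + -1) = n by omega)) +
          (CochainComplex.mappingCone.snd (Hom.app φ x)).comp
            ((N.act f).comp (Cochain.ofHom (CochainComplex.mappingCone.inr (Hom.app φ y)))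
              (add_zero n)) (zero_add n)).comp
        (CochainComplex.mappingCone.fst (Hom.app φ y)).1 h = _
  rw [Cochain.add_comp, Cochain.units_smul_comp]
  rw [Cochain.comp_assoc _ _ _ _ (show n + -1 + 1 = n by omega) (by omega),
    Cochain.comp_assoc _ _ _ _ (show -1 + 1 = 0 by omega) (by omega),
    CochainComplex.mappingCone.inl_fst]
  simp

lemma cofiberAct_comp_snd {x y : T.Ob} {n : ℤ} (f : (T.Hom y x).X n) :
    (cofiberAct φ f).comp (CochainComplex.mappingCone.snd (Hom.app φ y)) (add_zero n) =
      (CochainComplex.mappingCone.snd (Hom.app φ x)).comp (N.act f) (zero_add n) := by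
  change (n.negOnePow • ((CochainComplex.mappingCone.fst (Hom.app φ x)).1.comp
            ((M.act f).comp (CochainComplex.mappingCone.inl (Hom.app φ y)) rfl)
              (show 1 + (n + -1) = n by omega)) +
          (CochainComplex.mappingCone.snd (Hom.app φ x)).comp
            ((N.act f).comp (Cochain.ofHom (CochainComplex.mappingCone.inr (Hom.app φ y)))
              (add_zero n)) (zero_add n)).comp
        (CochainComplex.mappingCone.snd (Hom.app φ y)) (add_zero n) = _
  rw [Cochain.add_comp, Cochain.units_smul_comp]
  rw [Cochain.comp_assoc _ _ _ _ (show n + -1 + 0 = n - 1 by omega) (by omega),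
    Cochain.comp_assoc _ _ _ _ (show -1 + 0 = -1 by omega) (by omega),
    CochainComplex.mappingCone.inl_snd]
  simp

lemma inl_comp_cofiberAct {x y : T.Ob} {n m : ℤ} (h : -1 + n = m) (h' : n + -1 = m)
    (f : (T.Hom y x).X n) :
    (CochainComplex.mappingCone.inl (Hom.app φ x)).comp (cofiberAct φ f) h =
      n.negOnePow • (M.act f).comp (CochainComplex.mappingCone.inl (Hom.app φ y)) h' := by
  subst h'
  change (CochainComplex.mappingCone.inl (Hom.app φ x)).comp
    (n.negOnePow • ((CochainComplex.mappingCone.fst (Hom.app φ x)).1.comp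
            ((M.act f).comp (CochainComplex.mappingCone.inl (Hom.app φ y)) rfl)
              (show 1 + (n + -1) = n by omega)) +
          (CochainComplex.mappingCone.snd (Hom.app φ x)).comp
            ((N.act f).comp (Cochain.ofHom (CochainComplex.mappingCone.inr (Hom.app φ y)))
              (add_zero n)) (zero_add n)) h = _
  rw [Cochain.comp_add, Cochain.comp_units_smul, CochainComplex.mappingCone.inl_fst_assoc,
    CochainComplex.mappingCone.inl_snd_assoc, add_zero]

lemma inr_comp_cofiberAct {x y : T.Ob} {n : ℤ} (f : (T.Hom y x).X n) :
    (Cochain.ofHom (CochainComplex.mappingCone.inr (Hom.app φ x))).comp (cofiberAct φ f)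
      (zero_add n) =
      (N.act f).comp (Cochain.ofHom (CochainComplex.mappingCone.inr (Hom.app φ y)))
        (add_zero n) := by
  change (Cochain.ofHom (CochainComplex.mappingCone.inr (Hom.app φ x))).comp
    (n.negOnePow • ((CochainComplex.mappingCone.fst (Hom.app φ x)).1.comp
            ((M.act f).comp (CochainComplex.mappingCone.inl (Hom.app φ y)) rfl)
              (show 1 + (n + -1) = n by omega)) +
          (CochainComplex.mappingCone.snd (Hom.app φ x)).comp
            ((N.act f).comp (Cochain.ofHom (CochainComplex.mappingCone.inr (Hom.app φ y)))
              (add_zero n)) (zero_add n)) (zero_add n) = _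
  rw [Cochain.comp_add, Cochain.comp_units_smul, CochainComplex.mappingCone.inr_fst_assoc,
    CochainComplex.mappingCone.inr_snd_assoc, smul_zero, zero_add]

lemma cofiberFst_smul {x y : T.Ob} {n p q p' q' : ℤ} (h : p + n = q) (hp : p + 1 = p')
    (hq : q + 1 = q') (f : (T.Hom y x).X n) (t : ((cofiber φ).cx x).X p) :
    cofiberFst φ y hq ((cofiber φ).smul h f t) =
      n.negOnePow • M.smul (show p' + n = q' by omega) f (cofiberFst φ x hp t) := by
  have h₁ := Cochain.congr_v (cofiberAct_comp_fst φ (rfl : n + 1 = n + 1) (add_comm 1 n) f) p q'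
    (by omega)
  rw [Cochain.comp_v _ _ _ p q q' h hq] at h₁
  rw [Cochain.units_smul_v] at h₁
  rw [Cochain.comp_v _ _ _ p p' q' hp (by omega)] at h₁
  exact ConcreteCategory.congr_hom h₁ t

lemma cofiberSnd_smul {x y : T.Ob} {n p q : ℤ} (h : p + n = q)
    (f : (T.Hom y x).X n) (t : ((cofiber φ).cx x).X p) :
    cofiberSnd φ y q ((cofiber φ).smul h f t) = N.smul h f (cofiberSnd φ x p t) := by
  have h₁ := Cochain.congr_v (cofiberAct_comp_snd φ f) p q h
  rw [Cochain.comp_zero_cochain_v, Cochain.zero_cochain_comp_v] at h₁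
  exact ConcreteCategory.congr_hom h₁ t

end DGModule

end Cofiber

/-! ### Pretriangulated dg categories from strict desuspensions and cones -/

section Pretriangulated

variable {k : Type u} [Field k]

namespace DGCat.ConeData

variable {D : DGCat.{w} k} {a b c : D.Ob} {f : (D.Hom a b).X 0} (C : D.ConeData f c)

lemma decomp_to {e : D.Ob} {q r : ℤ} (h : q + 1 = r) (g : (D.Hom e c).X q) :
    D.comp (show r + -1 = q by omega) (D.comp h g C.fst) C.inl +
      D.comp (add_zero q) (D.comp (add_zero q) g C.snd) C.inr = g := by
  rw [D.assoc h (add_neg_cancel 1) (by omega) (add_zero q),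
    D.assoc (add_zero q) (add_zero 0) (add_zero q) (add_zero q), ← map_add,
    C.fst_inl_add_snd_inr, D.comp_one]

lemma comp_inl_fst {e : D.Ob} {q r : ℤ} (h : r + -1 = q) (h' : q + 1 = r)
    (g : (D.Hom e a).X r) : D.comp h' (D.comp h g C.inl) C.fst = g := by
  rw [D.assoc h (neg_add_cancel 1) h' (add_zero r), C.inl_fst, D.comp_one]

lemma comp_inl_snd {e : D.Ob} {q r : ℤ} (h : r + -1 = q) (g : (D.Hom e a).X r) :
    D.comp (add_zero q) (D.comp h g C.inl) C.snd = 0 := by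
  rw [D.assoc h (add_zero (-1)) (add_zero q) h, C.inl_snd, map_zero]

lemma comp_inr_fst {e : D.Ob} {q r : ℤ} (h : q + 1 = r) (g : (D.Hom e b).X q) :
    D.comp h (D.comp (add_zero q) g C.inr) C.fst = 0 := by
  rw [D.assoc (add_zero q) (zero_add 1) h h, C.inr_fst, map_zero]

lemma comp_inr_snd {e : D.Ob} {q : ℤ} (g : (D.Hom e b).X q) :
    D.comp (add_zero q) (D.comp (add_zero q) g C.inr) C.snd = g := by
  rw [D.assoc (add_zero q) (add_zero 0) (add_zero q) (add_zero q), C.inr_snd, D.comp_one]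

lemma d_comp_inl {e : D.Ob} {q r r' : ℤ} (h : r + -1 = q) (hr : r + 1 = r')
    (g : (D.Hom e a).X r) :
    (D.Hom e c).d q r (D.comp h g C.inl) =
      D.comp (add_zero r) (D.comp (add_zero r) g f) C.inr -
        D.comp (show r' + -1 = r by omega) ((D.Hom e a).d r r' g) C.inl := by
  rw [D.d_comp' h hr (show (-1 : ℤ) + 1 = 0 by norm_num) (by omega), C.d_inl,
    D.assoc (add_zero r) (add_zero 0) (add_zero r) (add_zero r), Int.negOnePow_neg,
    Int.negOnePow_one, Units.neg_smul, one_smul]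
  abel

lemma d_comp_inr {e : D.Ob} {q r : ℤ} (hr : q + 1 = r) (g : (D.Hom e b).X q) :
    (D.Hom e c).d q r (D.comp (add_zero q) g C.inr) =
      D.comp (add_zero r) ((D.Hom e b).d q r g) C.inr := by
  rw [D.d_comp_of_d_eq_zero' (add_zero q) hr (zero_add 1) hr g C.d_inr, Int.negOnePow_zero,
    one_smul]

end DGCat.ConeData

namespace DGModule

variable {T : DGCat.{w} k}

lemma zero_cx_eq_zero {x : T.Ob} {n : ℤ} (t : ((zero T).cx x).X n) : t = 0 := by
  have h := (HomologicalComplex.isZero_zero (V := ModuleCat.{u} k)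
    (c := ComplexShape.up ℤ)).eq_of_src (𝟙 _) 0
  exact ConcreteCategory.congr_hom (congrArg (fun φ => φ.f n) h) t

/-- The action of a closed morphism commutes with the differential up to sign. -/
lemma smul_d_of_d_eq_zero (M : DGModule T) {x y : T.Ob} {n p q n' p' q' : ℤ} (h : p + n = q)
    (hn : n + 1 = n') (hp : p + 1 = p') (hq : q + 1 = q') {f : (T.Hom y x).X n}
    (hf : (T.Hom y x).d n n' f = 0) (z : (M.cx x).X p) :
    M.smul (show p' + n = q' by omega) f ((M.cx x).d p p' z) =
      (M.cx y).d q q' (n.negOnePow • M.smul h f z) := by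
  rw [ModuleCat.hom_negOnePow_smul, M.d_smul h hn hp hq, hf, map_zero, LinearMap.zero_apply,
    zero_add, negOnePow_smul_smul, negOnePow_smul_congr (b := 0) ⟨n, by ring⟩]
  simp

/-- The action on a closed element commutes with the differential. -/
lemma d_smul_of_d_eq_zero (M : DGModule T) {x y : T.Ob} {n p q n' p' q' : ℤ} (h : p + n = q)
    (hn : n + 1 = n') (hp : p + 1 = p') (hq : q + 1 = q') (f : (T.Hom y x).X n)
    {z : (M.cx x).X p} (hz : (M.cx x).d p p' z = 0) :
    (M.cx y).d q q' (M.smul h f z) =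
      M.smul (show p + n' = q' by omega) ((T.Hom y x).d n n' f) z := by
  rw [M.d_smul h hn hp hq, hz, map_zero, smul_zero, add_zero]

/-- Given generators of `M` at `a` and of `N` at `b`, a morphism `M ⟶ N` is represented up to
homotopy by a closed morphism `f : a ⟶ b`, and a cone of `f` represents the cofiber: if
`φ x = f y + d w`, the element `(fst x, snd y + fst w)` of the cofiber is a generator. The proof
of the last point is that of the five lemma. -/
lemma Generates.cofiber {M N : DGModule T} {φ : M ⟶ N} {a b c : T.Ob} {x : (M.cx a).X 0}
    {y : (N.cx b).X 0} (hx : M.Generates x) (hy : N.Generates y) {f : (T.Hom a b).X 0}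
    (hf : (T.Hom a b).d 0 1 f = 0) {w : (N.cx a).X (-1)}
    (hw : (Hom.app φ a).f 0 x = N.smul (zero_add 0) f y + (N.cx a).d (-1) 0 w)
    (C : T.ConeData f c) : ∃ z : ((cofiber φ).cx c).X 0, (cofiber φ).Generates z := by
  have hxy (e : T.Ob) {m n : ℤ} (h : m + 1 = n) (g : (T.Hom e a).X n)
      (hg : (T.Hom e a).d n (n + 1) g = 0) :
      (Hom.app φ e).f n (M.smul (zero_add n) g x) =
        N.smul (zero_add n) (T.comp (add_zero n) g f) y +
          (N.cx e).d m n (n.negOnePow • N.smul (show -1 + n = m by omega) g w) := by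
    rw [Hom.app_smul, hw, map_add, N.smul_smul' _ _ (add_zero n) (zero_add n), zero_mul,
      Int.negOnePow_zero, one_smul,
      N.smul_d_of_d_eq_zero (show -1 + n = m by omega) rfl (by norm_num) h hg]
  obtain ⟨z, hz₁, hz₂⟩ := cofiber_exists φ c (zero_add 1) (M.smul (zero_add 1) C.fst x)
    (N.smul (zero_add 0) C.snd y + N.smul (show (-1 : ℤ) + 1 = 0 by norm_num) C.fst w)
  -- the action on `z` in terms of the components of a morphism to the cone
  have act₁ (e : T.Ob) {q q' : ℤ} (h : q + 1 = q') (g : (T.Hom e c).X q) :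
      cofiberFst φ e h ((DGModule.cofiber φ).smul (zero_add q) g z) =
        M.smul (zero_add q') (T.comp h g C.fst) x := by
    rw [cofiberFst_smul φ (zero_add q) (zero_add 1) h, hz₁,
      M.smul_smul' _ _ h (zero_add q'), negOnePow_smul_smul,
      negOnePow_smul_congr (b := 0) ⟨q, by ring⟩, Int.negOnePow_zero, one_smul]
  have act₂ (e : T.Ob) {q q' : ℤ} (h : q + 1 = q') (g : (T.Hom e c).X q) :
      cofiberSnd φ e q ((DGModule.cofiber φ).smul (zero_add q) g z) =
        N.smul (zero_add q) (T.comp (add_zero q) g C.snd) y +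
          q.negOnePow • N.smul (show -1 + q' = q by omega) (T.comp h g C.fst) w := by
    rw [cofiberSnd_smul, hz₂, map_add, N.smul_smul' _ _ (add_zero q) (zero_add q),
      N.smul_smul' _ _ h (show -1 + q' = q by omega), zero_mul, Int.negOnePow_zero, one_smul,
      one_mul]
  have hz : ((DGModule.cofiber φ).cx c).d 0 1 z = 0 := by
    refine cofiber_ext (show (1 : ℤ) + 1 = 2 by norm_num) ?_ ?_
    · rw [cofiberFst_d φ c (zero_add 1), hz₁, M.d_smul_of_d_eq_zero (zero_add 1)
        (show (1 : ℤ) + 1 = 2 by norm_num) (zero_add 1) (show (1 : ℤ) + 1 = 2 by norm_num) _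
        hx.d_eq_zero, C.d_fst]
      simp only [map_zero, LinearMap.zero_apply, neg_zero]
    · rw [cofiberSnd_d φ c (zero_add 1), hz₁, hz₂, map_add,
        N.d_smul_of_d_eq_zero (zero_add 0) (zero_add 1) (zero_add 1) (zero_add 1) _
          hy.d_eq_zero, C.d_snd, hxy c (zero_add 1) C.fst C.d_fst, ModuleCat.hom_negOnePow_smul,
        Int.negOnePow_one, Units.neg_smul, one_smul]
      rw [map_neg, LinearMap.neg_apply, map_zero]
      abel
  refine ⟨z, hz, fun e p q hq t ht => ?_, fun e p q hq K hK t ht => ?_⟩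
  -- surjectivity in cohomology
  · have hm : (M.cx e).d (q + 1) (q + 1 + 1) (cofiberFst φ e rfl t) = 0 := by
      rw [← neg_eq_zero, ← cofiberFst_d φ e rfl rfl, ht, map_zero]
    have hn : (Hom.app φ e).f (q + 1) (cofiberFst φ e rfl t) +
        (N.cx e).d q (q + 1) (cofiberSnd φ e q t) = 0 := by
      rw [← cofiberSnd_d, ht, map_zero]
    obtain ⟨g, hg, m', hm'⟩ := hx.surj e q (q + 1) rfl _ hm
    have hgf : (T.Hom e b).d (q + 1) (q + 1 + 1) (T.comp (add_zero (q + 1)) g f) = 0 := by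
      rw [T.d_comp_of_d_eq_zero _ rfl (zero_add 1) rfl hg, hf, map_zero]
    rw [hm', map_add, hxy e rfl g hg, CochainComplex.f_d_apply] at hn
    obtain ⟨h, hh⟩ := hy.inj e q (q + 1) rfl _ hgf (-cofiberSnd φ e q t - (Hom.app φ e).f q m' -
      (q + 1).negOnePow • N.smul (show -1 + (q + 1) = q by omega) g w) (by
        rw [map_sub, map_sub, map_neg, ← sub_eq_zero, ← hn]
        abel)
    obtain ⟨h', hh', n', hn'⟩ := hy.surj e p q hq (N.smul (zero_add q) h y + cofiberSnd φ e q t +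
      (Hom.app φ e).f q m' +
      (q + 1).negOnePow • N.smul (show -1 + (q + 1) = q by omega) g w) (by
        rw [map_add, map_add, map_add, N.d_smul_of_d_eq_zero _ rfl (zero_add 1) rfl _ hy.d_eq_zero,
          ← hh, ← hn]
        abel)
    obtain ⟨s, hs₁, hs₂⟩ := cofiber_exists φ e hq (-m') n'
    refine ⟨T.comp (show q + 1 + -1 = q by omega) g C.inl +
      T.comp (add_zero q) (h' - h) C.inr, ?_, s, cofiber_ext (rfl : q + 1 = q + 1) ?_ ?_⟩
    · rw [map_add, C.d_comp_inl _ rfl, hg, C.d_comp_inr rfl, map_sub, hh', ← hh]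
      simp only [map_zero, map_neg, LinearMap.zero_apply, LinearMap.neg_apply, zero_sub, sub_zero]
      abel
    · rw [map_add, act₁ e rfl, map_add, LinearMap.add_apply, C.comp_inl_fst, C.comp_inr_fst,
        add_zero, cofiberFst_d φ e hq rfl, hs₁, hm', map_neg, neg_neg]
    · have hn'' := eq_sub_of_add_eq hn'.symm
      rw [map_add, act₂ e rfl, map_add, map_add, LinearMap.add_apply, LinearMap.add_apply,
        C.comp_inl_fst, C.comp_inr_fst, C.comp_inl_snd, C.comp_inr_snd, cofiberSnd_d φ e hq, hs₁,
        hs₂, add_zero, zero_add, map_sub, LinearMap.sub_apply, hn'', map_neg, Int.negOnePow_succ,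
        Units.neg_smul]
      abel
  -- injectivity in cohomology
  · have h₁ : M.smul (zero_add (q + 1)) (T.comp rfl K C.fst) x =
        (M.cx e).d q (q + 1) (-cofiberFst φ e hq t) := by
      rw [← act₁ e rfl, ht, cofiberFst_d φ e hq rfl, map_neg]
    have h₂ := act₂ e rfl K
    rw [ht, cofiberSnd_d φ e hq] at h₂
    have hg : (T.Hom e a).d (q + 1) (q + 1 + 1) (T.comp rfl K C.fst) = 0 := by
      rw [T.d_comp_of_d_eq_zero rfl rfl (show (1 : ℤ) + 1 = 2 by norm_num) rfl hK, C.d_fst,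
        map_zero]
    obtain ⟨v, hv⟩ := hx.inj e q (q + 1) rfl _ hg _ h₁
    obtain ⟨g', hg', m', hm'⟩ := hx.surj e p q hq
      (cofiberFst φ e hq t + M.smul (zero_add q) v x) (by
        rw [map_add, M.d_smul_of_d_eq_zero _ rfl (zero_add 1) rfl _ hx.d_eq_zero, ← hv, h₁, map_neg,
          add_neg_cancel])
    have hd : (T.Hom e b).d q (q + 1) (T.comp (add_zero q) K C.snd +
        T.comp (add_zero q) v f - T.comp (add_zero q) g' f) = 0 := by
      rw [map_sub, map_add, T.d_comp_of_d_eq_zero _ rfl (zero_add 1) rfl hK,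
        T.d_comp_of_d_eq_zero _ rfl (zero_add 1) rfl hg', C.d_snd,
        T.d_comp_of_d_eq_zero' _ rfl (zero_add 1) rfl _ hf, ← hv, hf, map_neg,
        ← T.assoc rfl (add_zero 1) (add_zero (q + 1)) rfl]
      simp
    obtain ⟨U, hU⟩ := hy.inj e p q hq _ hd (cofiberSnd φ e p t -
      q.negOnePow • N.smul (show -1 + q = p by omega) v w +
      q.negOnePow • N.smul (show -1 + q = p by omega) g' w + (Hom.app φ e).f p m') (by
        have h₃ := congrArg ((Hom.app φ e).f q) hm'
        rw [map_add, map_add, hxy e hq g' hg', CochainComplex.f_d_apply, Hom.app_smul, hw, map_add,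
          N.smul_smul' _ _ (add_zero q) (zero_add q), zero_mul, Int.negOnePow_zero,
          one_smul] at h₃
        have h₄ := N.d_smul (show -1 + q = p by omega) rfl (show (-1 : ℤ) + 1 = 0 by norm_num) hq
          v w
        rw [← hv] at h₄
        rw [map_sub, map_add, LinearMap.sub_apply, LinearMap.add_apply, map_add, map_add, map_sub]
        rw [ModuleCat.hom_negOnePow_smul _ q (N.smul _ v w), h₄, smul_add, negOnePow_smul_smul,
          negOnePow_smul_congr (a := q + q) (b := 0) ⟨q, by ring⟩, Int.negOnePow_zero, one_smul]
        rw [← sub_eq_zero] at h₂ h₃ ⊢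
        refine Eq.trans ?_ ((congrArg₂ (· - ·) h₃ h₂).trans (sub_zero 0))
        dsimp only
        abel)
    refine ⟨-T.comp (show q + -1 = p by omega) v C.inl + T.comp (add_zero p) U C.inr +
      T.comp (show q + -1 = p by omega) g' C.inl, ?_⟩
    rw [map_add, map_add, map_neg, C.d_comp_inl _ rfl, C.d_comp_inl _ rfl, C.d_comp_inr hq, ← hU,
      ← hv, hg']
    conv_lhs => rw [← C.decomp_to rfl K]
    simp only [map_add, map_sub, map_zero, LinearMap.add_apply, LinearMap.sub_apply,
      LinearMap.zero_apply]
    abel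

end DGModule

namespace DGCat

/-- A dg category with a zero object (an object whose identity is zero), desuspensions and cones of
closed morphisms of degree `0` is pretriangulated. Modules weakly equivalent to representable ones
are handled by their generators, so that no morphism of modules has to be replaced by a morphism of
representable modules. -/
lemma isPretriangulated_of_exists (T : DGCat.{w} k) (o : T.Ob) (ho : T.one o = 0)
    (hshift : ∀ c : T.Ob, ∃ d : T.Ob, Nonempty (T.IsoOfDegree d c (-1)))
    (hcone : ∀ (a b : T.Ob) (f : (T.Hom a b).X 0), (T.Hom a b).d 0 1 f = 0 →
      ∃ c : T.Ob, Nonempty (T.ConeData f c)) :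
    T.IsPretriangulated where
  exists_zero := by
    -- all morphisms to `o` are zero, so that the element `0` generates the zero module
    have hg (x : T.Ob) (n : ℤ) (g : (T.Hom x o).X n) : g = 0 := by
      rw [← T.comp_one g, ho, map_zero]
    refine ⟨o, .symm _ _ (DGModule.Generates.weaklyEquivalent
      (z := (0 : ((DGModule.zero T).cx o).X 0)) ⟨map_zero _, ?_, ?_⟩)⟩
    · exact fun _ _ _ _ _ _ => ⟨0, map_zero _, 0,
        (DGModule.zero_cx_eq_zero _).trans (DGModule.zero_cx_eq_zero _).symm⟩
    · exact fun x m n h g _ _ _ => ⟨0, (hg x n g).trans (map_zero _).symm⟩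
  desuspension M c h := by
    obtain ⟨z, hz⟩ := (DGModule.weaklyEquivalent_representable_iff _ c).1 h
    obtain ⟨d, ⟨e⟩⟩ := hshift c
    exact ⟨d, (DGModule.Generates.desuspension (M := M) (z := z) hz e).weaklyEquivalent⟩
  cofiber M N a b hM hN φ := by
    obtain ⟨x, hx⟩ := (DGModule.weaklyEquivalent_representable_iff _ a).1 hM
    obtain ⟨y, hy⟩ := (DGModule.weaklyEquivalent_representable_iff _ b).1 hN
    -- the image under `φ` of the generator `x` of `M` is cohomologous to `f y` for a closed `f`
    obtain ⟨f, hf, w, hw⟩ := hy.surj a (-1) 0 (by norm_num) ((DGModule.Hom.app φ a).f 0 x) (by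
      rw [← CochainComplex.f_d_apply]
      exact (congrArg _ hx.d_eq_zero).trans (map_zero _))
    obtain ⟨c, ⟨C⟩⟩ := hcone a b f hf
    obtain ⟨z, hz⟩ := hx.cofiber hy hf hw C
    exact ⟨c, hz.weaklyEquivalent⟩

end DGCat

end Pretriangulated

/-! ### The dg category of modules -/

section Modules

variable {k : Type u} [Field k]

/-- The dg category `Fun_dg(T^op, Ch(k))` of all right modules over a small dg category. It is
definitionally `T.op.functors (DGCat.ch k)`, with fields spelled out so that its type of objects
reduces to `DGModule T`. -/
abbrev DGCat.modules (T : DGCat.{u} k) : DGCat.{u + 1} k where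
  Ob := DGModule T
  Hom M N := M.natComplex N
  comp h := (T.op.functors (DGCat.ch k)).comp h
  one M := (T.op.functors (DGCat.ch k)).one M
  d_comp h f g := (T.op.functors (DGCat.ch k)).d_comp h f g
  d_one M := (T.op.functors (DGCat.ch k)).d_one M
  one_comp f := (T.op.functors (DGCat.ch k)).one_comp f
  comp_one f := (T.op.functors (DGCat.ch k)).comp_one f
  assoc hpq hqr h h' f g e := (T.op.functors (DGCat.ch k)).assoc hpq hqr h h' f g e

namespace CochainComplex

variable (K : CochainComplex (ModuleCat.{u} k) ℤ)

/-- The identity of `K`, as a cochain `K[a] ⟶ K` of degree `a`. -/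
noncomputable def unshiftCochain (a : ℤ) :
    Cochain ((CategoryTheory.shiftFunctor _ a).obj K) K a :=
  (Cochain.ofHom (𝟙 ((CategoryTheory.shiftFunctor _ a).obj K))).rightUnshift a (zero_add a)

/-- The identity of `K`, as a cochain `K ⟶ K[a]` of degree `-a`. -/
noncomputable def shiftCochain (a : ℤ) :
    Cochain K ((CategoryTheory.shiftFunctor _ a).obj K) (-a) :=
  (Cochain.ofHom (𝟙 K)).rightShift a (-a) (neg_add_cancel a)

lemma unshiftCochain_v (a p q : ℤ) (h : p + a = q) :
    (K.unshiftCochain a).v p q h = (K.shiftFunctorObjXIso a p q h.symm).hom := by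
  rw [unshiftCochain, Cochain.rightUnshift_v _ _ _ p q h p (add_zero p), Cochain.ofHom_v,
    HomologicalComplex.id_f, Category.id_comp]

lemma shiftCochain_v (a p q : ℤ) (h : p + -a = q) :
    (K.shiftCochain a).v p q h = (K.shiftFunctorObjXIso a q p (by omega)).inv := by
  rw [shiftCochain, Cochain.rightShift_v _ _ _ _ p q h p (add_zero p), Cochain.ofHom_v,
    HomologicalComplex.id_f, Category.id_comp]

lemma δ_unshiftCochain (a : ℤ) : δ a (a + 1) (K.unshiftCochain a) = 0 := by
  rw [unshiftCochain, Cochain.δ_rightUnshift _ _ _ _ 1 (add_comm 1 a), δ_ofHom,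
    Cochain.rightUnshift_zero, smul_zero]

lemma δ_shiftCochain (a : ℤ) : δ (-a) (-a + 1) (K.shiftCochain a) = 0 := by
  rw [shiftCochain, Cochain.δ_rightShift _ _ _ _ _ 1 (by omega), δ_ofHom,
    Cochain.rightShift_zero, smul_zero]

lemma unshiftCochain_comp_shiftCochain (a : ℤ) :
    (K.unshiftCochain a).comp (K.shiftCochain a) (add_neg_cancel a) = Cochain.ofHom (𝟙 _) := by
  ext p : 1
  rw [Cochain.comp_v _ _ _ p (p + a) p rfl (by omega), unshiftCochain_v, shiftCochain_v,
    Iso.hom_inv_id, Cochain.ofHom_v, HomologicalComplex.id_f]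

lemma shiftCochain_comp_unshiftCochain (a : ℤ) :
    (K.shiftCochain a).comp (K.unshiftCochain a) (neg_add_cancel a) = Cochain.ofHom (𝟙 _) := by
  ext p : 1
  rw [Cochain.comp_v _ _ _ p (p + -a) p rfl (by omega), unshiftCochain_v, shiftCochain_v,
    Iso.inv_hom_id, Cochain.ofHom_v, HomologicalComplex.id_f]

variable {K} {L : CochainComplex (ModuleCat.{u} k) ℤ}

lemma shift_comp_unshiftCochain {a n m : ℤ} (γ : Cochain K L n) (h : n + a = m)
    (h' : a + n = m) :
    (γ.shift a).comp (L.unshiftCochain a) h = (K.unshiftCochain a).comp γ h' := by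
  ext p q hpq : 1
  rw [Cochain.comp_v _ _ _ p (p + n) q rfl (by omega),
    Cochain.comp_v _ _ _ p (p + a) q rfl (by omega), unshiftCochain_v, unshiftCochain_v,
    Cochain.shift_v γ a p (p + n) rfl (p + a) q rfl (by omega), Category.assoc, Category.assoc,
    Iso.inv_hom_id, Category.comp_id]

lemma shiftCochain_comp_shift {a n m : ℤ} (γ : Cochain K L n) (h : n + -a = m)
    (h' : -a + n = m) :
    (K.shiftCochain a).comp (γ.shift a) h' = γ.comp (L.shiftCochain a) h := by
  ext p q hpq : 1
  rw [Cochain.comp_v _ _ _ p (p + n) q rfl (by omega),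
    Cochain.comp_v _ _ _ p (p + -a) q rfl (by omega), shiftCochain_v, shiftCochain_v,
    Cochain.shift_v γ a (p + -a) q (by omega) p (p + n) (by omega) (by omega),
    Iso.inv_hom_id_assoc]

end CochainComplex

namespace DGModule

variable {T : DGCat.{u} k}

/-- A dg natural transformation of degree `n` between modules, as an element of the complex of
morphisms, from its components. -/
def mkNat {M N : DGModule T} {n : ℤ} (α : ∀ x : T.Ob, Cochain (M.cx x) (N.cx x) n)
    (hα : ∀ (x y : T.Ob) (p m : ℤ) (h : p + n = m) (h' : n + p = m) (f : (T.Hom y x).X p),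
      (M.act f).comp (α y) h = (n * p).negOnePow • (α x).comp (N.act f) h') :
    (T.modules.Hom M N).X n :=
  ⟨α, fun x y p m h f => hα x y p m h (by omega) f⟩

/-- The component of a dg natural transformation at an object. -/
def natApp {M N : DGModule T} {n : ℤ} (α : (T.modules.Hom M N).X n) (x : T.Ob) :
    Cochain (M.cx x) (N.cx x) n := α.1 x

/-- The value of a dg natural transformation on an element. -/
def eval {M N : DGModule T} {n p q : ℤ} (x : T.Ob) (h : p + n = q) :
    (T.modules.Hom M N).X n →ₗ[k] (M.cx x).X p →ₗ[k] (N.cx x).X q :=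
  LinearMap.mk₂ k (fun α z => (natApp α x).v p q h z)
    (fun _ _ _ => rfl) (fun _ _ _ => rfl)
    (fun _ z z' => map_add _ z z') (fun c α z => map_smul ((natApp α x).v p q h).hom c z)

lemma nat_ext {M N : DGModule T} {n : ℤ} {α β : (T.modules.Hom M N).X n}
    (h : ∀ (x : T.Ob) (p q : ℤ) (h : p + n = q) (z : (M.cx x).X p), eval x h α z = eval x h β z) :
    α = β := by
  refine Subtype.ext (funext fun x => ?_)
  refine Cochain.ext _ _ fun p q hpq => ?_
  exact ModuleCat.hom_ext (LinearMap.ext fun z => h x p q hpq z)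

lemma eval_comp {M N P : DGModule T} {m n mn p q r : ℤ} (x : T.Ob) (hm : p + m = q)
    (hn : q + n = r) (h : m + n = mn) (h' : p + mn = r)
    (α : (T.modules.Hom M N).X m) (β : (T.modules.Hom N P).X n) (z : (M.cx x).X p) :
    eval x h' (T.modules.comp h α β) z = eval x hn β (eval x hm α z) :=
  ConcreteCategory.congr_hom (Cochain.comp_v (natApp α x) (natApp β x) h p q r hm hn) z

lemma eval_one {M : DGModule T} {p : ℤ} (x : T.Ob) (z : (M.cx x).X p) :
    eval x (add_zero p) (T.modules.one M) z = z :=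
  ConcreteCategory.congr_hom (Cochain.ofHom_v (𝟙 (M.cx x)) p) z

lemma d_eval {M N : DGModule T} {n p q n' p' q' : ℤ} (x : T.Ob) (h : p + n = q)
    (hn : n + 1 = n') (hp : p + 1 = p') (hq : q + 1 = q') (α : (T.modules.Hom M N).X n)
    (z : (M.cx x).X p) :
    (N.cx x).d q q' (eval x h α z) =
      eval x (show p + n' = q' by omega) ((T.modules.Hom M N).d n n' α) z +
        n.negOnePow • eval x (show p' + n = q' by omega) α ((M.cx x).d p p' z) := by
  subst hn
  have h₁ := δ_v n (n + 1) rfl (natApp α x) p q' (by omega) q p' (by omega) hp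
  have h₂ : eval x (show p + (n + 1) = q' by omega) ((T.modules.Hom M N).d n (n + 1) α) z =
      (N.cx x).d q q' (eval x h α z) +
      (n + 1).negOnePow • eval x (show p' + n = q' by omega) α ((M.cx x).d p p' z) :=
    ConcreteCategory.congr_hom h₁ z
  rw [h₂, Int.negOnePow_succ, Units.neg_smul]
  abel

lemma eval_smul {M N : DGModule T} {n m p q r s : ℤ} {x y : T.Ob} (hm : p + m = q)
    (hn : q + n = r) (hn' : p + n = s) (hm' : s + m = r) (α : (T.modules.Hom M N).X n)
    (f : (T.Hom y x).X m) (z : (M.cx x).X p) :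
    eval y hn α (M.smul hm f z) = (n * m).negOnePow • N.smul hm' f (eval x hn' α z) := by
  have h₁ : (M.act f).comp (natApp α y) rfl =
    (n * m).negOnePow • (natApp α x).comp (N.act f) (add_comm n m) := α.2 x y m (m + n) rfl f
  have h₂ := Cochain.congr_v h₁ p r (by omega)
  rw [Cochain.comp_v _ _ _ p q r hm hn, Cochain.units_smul_v, Cochain.comp_v _ _ _ p s r hn' hm']
    at h₂
  exact ConcreteCategory.congr_hom h₂ z

/-- A closed dg natural transformation of degree `0`, as a morphism of modules. -/
def homOfNat {M N : DGModule T} (α : (T.modules.Hom M N).X 0)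
    (hα : (T.modules.Hom M N).d 0 1 α = 0) : M ⟶ N where
  app x :=
    { f := fun p => ModuleCat.ofHom (eval x (add_zero p) α)
      comm' := fun p p' h => by
        refine ModuleCat.hom_ext (LinearMap.ext fun (z : (M.cx x).X p) => ?_)
        change (N.cx x).d p p' (eval x (add_zero p) α z) =
          eval x (add_zero p') α ((M.cx x).d p p' z)
        rw [d_eval x (add_zero p) (zero_add 1) h h, hα, map_zero, LinearMap.zero_apply, zero_add,
          Int.negOnePow_zero, one_smul] }
  naturality {x y n} f := by
    ext p q h : 1
    rw [Cochain.comp_zero_cochain_v, Cochain.zero_cochain_comp_v, Cochain.ofHom_v,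
      Cochain.ofHom_v]
    refine ModuleCat.hom_ext (LinearMap.ext fun (e : (M.cx x).X p) => ?_)
    change eval y (add_zero q) α (M.smul h f e) = N.smul h f (eval x (add_zero p) α e)
    rw [eval_smul h (add_zero q) (add_zero p) h, zero_mul, Int.negOnePow_zero, one_smul]

lemma homOfNat_apply {M N : DGModule T} (α : (T.modules.Hom M N).X 0)
    (hα : (T.modules.Hom M N).d 0 1 α = 0) (x : T.Ob) (p : ℤ) (z : (M.cx x).X p) :
    (Hom.app (homOfNat α hα) x).f p z = eval x (add_zero p) α z := rfl

/-- A morphism of modules, as a dg natural transformation of degree `0`. -/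
def natOfHom {M N : DGModule T} (φ : M ⟶ N) : (T.modules.Hom M N).X 0 :=
  mkNat (fun x => Cochain.ofHom (Hom.app φ x)) fun x y p m h h' f => by
    obtain rfl : p = m := by omega
    rw [zero_mul, Int.negOnePow_zero, one_smul]
    exact Hom.naturality φ f

lemma eval_natOfHom {M N : DGModule T} (φ : M ⟶ N) (x : T.Ob) (p : ℤ) (z : (M.cx x).X p) :
    eval x (add_zero p) (natOfHom φ) z = (Hom.app φ x).f p z :=
  ConcreteCategory.congr_hom (Cochain.ofHom_v (Hom.app φ x) p) z

lemma d_natOfHom {M N : DGModule T} (φ : M ⟶ N) :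
    (T.modules.Hom M N).d 0 1 (natOfHom φ) = 0 :=
  Subtype.ext (funext fun x => δ_ofHom (Hom.app φ x))

lemma natOfHom_homOfNat {M N : DGModule T} (α : (T.modules.Hom M N).X 0)
    (hα : (T.modules.Hom M N).d 0 1 α = 0) : natOfHom (homOfNat α hα) = α := by
  refine nat_ext fun x p q h z => ?_
  obtain rfl : p = q := by omega
  exact eval_natOfHom _ x p z

lemma hom_ext_elements {M N : DGModule T} {φ ψ : M ⟶ N}
    (h : ∀ (x : T.Ob) (p : ℤ) (z : (M.cx x).X p),
      (Hom.app φ x).f p z = (Hom.app ψ x).f p z) : φ = ψ := by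
  refine Hom.ext (funext fun x => ?_)
  refine HomologicalComplex.hom_ext _ _ fun p => ModuleCat.hom_ext (LinearMap.ext fun z => ?_)
  exact h x p z

lemma comp_app_apply {M N P : DGModule T} (φ : M ⟶ N) (ψ : N ⟶ P) (x : T.Ob) (p : ℤ)
    (z : (M.cx x).X p) :
    (Hom.app (φ ≫ ψ) x).f p z = (Hom.app ψ x).f p ((Hom.app φ x).f p z) := rfl

lemma natOfHom_comp {M N P : DGModule T} (φ : M ⟶ N) (ψ : N ⟶ P) :
    natOfHom (φ ≫ ψ) = T.modules.comp (add_zero 0) (natOfHom φ) (natOfHom ψ) := by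
  refine nat_ext fun x p q h z => ?_
  obtain rfl : p = q := by omega
  rw [eval_natOfHom, eval_comp x (add_zero p) (add_zero p), eval_natOfHom, eval_natOfHom,
    comp_app_apply]

/-- The mapping cone of a morphism of modules is a cone in the dg category of modules. -/
noncomputable def cofiberConeData {M N : DGModule T} (φ : M ⟶ N) :
    T.modules.ConeData (natOfHom φ) (cofiber φ) where
  inl := mkNat (fun x => CochainComplex.mappingCone.inl (Hom.app φ x)) fun x y p m h h' f => by
    have h₁ : (-1 * p).negOnePow •
        (CochainComplex.mappingCone.inl (Hom.app φ x)).comp (cofiberAct φ f) h' =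
          (M.act f).comp (CochainComplex.mappingCone.inl (Hom.app φ y)) h := by
      rw [inl_comp_cofiberAct φ h' h f, negOnePow_smul_smul,
        negOnePow_smul_congr (b := 0) ⟨0, by ring⟩, Int.negOnePow_zero, one_smul]
    exact h₁.symm
  inr := mkNat (fun x => Cochain.ofHom (CochainComplex.mappingCone.inr (Hom.app φ x)))
    fun x y p m h h' f => by
    obtain rfl : p = m := by omega
    rw [zero_mul, Int.negOnePow_zero, one_smul]
    exact (inr_comp_cofiberAct φ f).symm
  fst := mkNat (fun x => (CochainComplex.mappingCone.fst (Hom.app φ x)).1) fun x y p m h h' f => by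
    rw [one_mul]
    exact cofiberAct_comp_fst φ h h' f
  snd := mkNat (fun x => CochainComplex.mappingCone.snd (Hom.app φ x)) fun x y p m h h' f => by
    obtain rfl : p = m := by omega
    rw [zero_mul, Int.negOnePow_zero, one_smul]
    exact cofiberAct_comp_snd φ f
  d_inl := Subtype.ext (funext fun x =>
    (CochainComplex.mappingCone.δ_inl (Hom.app φ x)).trans (Cochain.ofHom_comp _ _))
  d_inr := Subtype.ext (funext fun x => δ_ofHom _)
  d_fst := Subtype.ext (funext fun x => (CochainComplex.mappingCone.fst (Hom.app φ x)).δ_eq_zero 2)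
  d_snd := Subtype.ext (funext fun x => CochainComplex.mappingCone.δ_snd (Hom.app φ x))
  inl_fst := Subtype.ext (funext fun x => CochainComplex.mappingCone.inl_fst (Hom.app φ x))
  inl_snd := Subtype.ext (funext fun x => CochainComplex.mappingCone.inl_snd (Hom.app φ x))
  inr_fst := Subtype.ext (funext fun x => CochainComplex.mappingCone.inr_fst (Hom.app φ x))
  inr_snd := Subtype.ext (funext fun x => CochainComplex.mappingCone.inr_snd (Hom.app φ x))
  fst_inl_add_snd_inr :=
    Subtype.ext (funext fun x => CochainComplex.mappingCone.id (Hom.app φ x))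

/-- The pointwise shift `M[a]`, on which a morphism `f` acts as `(-1) ^ (a |f|)` times its action
on `M`. -/
noncomputable def shift (M : DGModule T) (a : ℤ) : DGModule T :=
  ofAct (fun x => (CategoryTheory.shiftFunctor _ a).obj (M.cx x))
    (fun x y n => (signSMul (k := k) _ (a * n)).comp
      ((Cochain.shiftLinearMap k (M.cx x) (M.cx y) n a).comp (M.actₗ x y n)))
    (fun x => by
      ext p : 1
      change (a * 0).negOnePow • ((M.act (T.one x)).shift a).v p p (add_zero p) = _
      rw [mul_zero, act_one, Int.negOnePow_zero, one_smul, Cochain.shift_v', Cochain.ofHom_v]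
      simp)
    (fun {x y z p q n} h h' f g => by
      change (p * q).negOnePow • (a * n).negOnePow • (M.act (T.comp h' g f)).shift a =
        ((a * p).negOnePow • (M.act f).shift a).comp ((a * q).negOnePow • (M.act g).shift a) h
      rw [Cochain.units_smul_comp, Cochain.comp_units_smul, negOnePow_smul_smul,
        negOnePow_smul_smul, ← mul_add, h, add_comm (p * q), ← negOnePow_smul_smul,
        ← Cochain.shift_units_smul, M.act_comp h h']
      congr 1
      ext r s hs : 1
      rw [Cochain.comp_v _ _ h r (r + p) s rfl (by omega), Cochain.shift_v', Cochain.shift_v',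
        Cochain.shift_v', Cochain.comp_v _ _ h (r + a) (r + p + a) (s + a) (by omega) (by omega)]
      rfl)
    (fun x y n f => by
      change δ n (n + 1) ((a * n).negOnePow • (M.act f).shift a) =
        (a * (n + 1)).negOnePow • (M.act ((T.Hom y x).d n (n + 1) f)).shift a
      rw [δ_units_smul, Cochain.δ_shift, negOnePow_smul_smul, M.act_d, mul_add, mul_one])

/-- The shift `M[a]` is isomorphic to `M` by an isomorphism of degree `a`. -/
noncomputable def shiftIso (M : DGModule T) (a : ℤ) :
    T.modules.IsoOfDegree (M.shift a) M a where
  hom := mkNat (fun x => (M.cx x).unshiftCochain a) fun x y p m h h' f => by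
    have h₁ : ((a * p).negOnePow • (M.act f).shift a).comp ((M.cx y).unshiftCochain a) h =
        (a * p).negOnePow • ((M.cx x).unshiftCochain a).comp (M.act f) h' := by
      rw [Cochain.units_smul_comp, CochainComplex.shift_comp_unshiftCochain (M.act f) h h']
    exact h₁
  inv := mkNat (fun x => (M.cx x).shiftCochain a) fun x y p m h h' f => by
    have h₁ : (M.act f).comp ((M.cx y).shiftCochain a) h = (-a * p).negOnePow •
        ((M.cx x).shiftCochain a).comp ((a * p).negOnePow • (M.act f).shift a) h' := by
      rw [Cochain.comp_units_smul, CochainComplex.shiftCochain_comp_shift (M.act f) h h',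
        negOnePow_smul_smul, negOnePow_smul_congr (b := 0) ⟨0, by ring⟩, Int.negOnePow_zero,
        one_smul]
    exact h₁
  d_hom := Subtype.ext (funext fun x => (M.cx x).δ_unshiftCochain a)
  d_inv := Subtype.ext (funext fun x => (M.cx x).δ_shiftCochain a)
  hom_inv_id := Subtype.ext (funext fun x => (M.cx x).unshiftCochain_comp_shiftCochain a)
  inv_hom_id := Subtype.ext (funext fun x => (M.cx x).shiftCochain_comp_unshiftCochain a)

end DGModule

end Modules

/-! ### Cofibrant modules are dg projective -/

section Cofibrant

variable {k : Type u} [Field k]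

namespace DGCat

variable {D : DGCat.{w} k}

lemma d_d_apply (D : DGCat.{w} k) {x y : D.Ob} (l m n : ℤ) (f : (D.Hom x y).X l) :
    (D.Hom x y).d m n ((D.Hom x y).d l m f) = 0 :=
  (D.Hom x y).d_d_apply l m n f

namespace IsoOfDegree

variable {x y : D.Ob} {n : ℤ} (e : D.IsoOfDegree x y n)

lemma comp_hom_inv {t : D.Ob} {p q : ℤ} (h : p + n = q) (h' : q + -n = p)
    (f : (D.Hom t x).X p) : D.comp h' (D.comp h f e.hom) e.inv = f := by
  rw [D.assoc h (add_neg_cancel n) h' (add_zero p), e.hom_inv_id, D.comp_one]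

lemma comp_inv_hom {t : D.Ob} {p q : ℤ} (h : p + -n = q) (h' : q + n = p)
    (f : (D.Hom t y).X p) : D.comp h' (D.comp h f e.inv) e.hom = f := by
  rw [D.assoc h (neg_add_cancel n) h' (add_zero p), e.inv_hom_id, D.comp_one]

lemma comp_inv_injective {t : D.Ob} {p q : ℤ} (h : p + -n = q) {f g : (D.Hom t y).X p}
    (hfg : D.comp h f e.inv = D.comp h g e.inv) : f = g := by
  rw [← e.comp_inv_hom h (by omega) f, hfg, e.comp_inv_hom]

lemma hom_inv_comp {t : D.Ob} {p q : ℤ} (h : -n + p = q) (h' : n + q = p)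
    (f : (D.Hom x t).X p) : D.comp h' e.hom (D.comp h e.inv f) = f := by
  rw [← D.assoc (add_neg_cancel n) h (zero_add p) h', e.hom_inv_id, D.one_comp]

lemma inv_hom_comp {t : D.Ob} {p q : ℤ} (h : n + p = q) (h' : -n + q = p)
    (f : (D.Hom y t).X p) : D.comp h' e.inv (D.comp h e.hom f) = f := by
  rw [← D.assoc (neg_add_cancel n) h (zero_add p) h', e.inv_hom_id, D.one_comp]

end IsoOfDegree

namespace ConeData

variable {a b c : D.Ob} {f : (D.Hom a b).X 0} (C : D.ConeData f c)

lemma decomp_from {e : D.Ob} {q r : ℤ} (h : -1 + q = r) (g : (D.Hom c e).X q) :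
    D.comp (show 1 + r = q by omega) C.fst (D.comp h C.inl g) +
      D.comp (zero_add q) C.snd (D.comp (zero_add q) C.inr g) = g := by
  rw [← D.assoc (add_neg_cancel 1) h (zero_add q) (by omega),
    ← D.assoc (add_zero 0) (zero_add q) (zero_add q) (zero_add q), ← LinearMap.add_apply, ← map_add,
    C.fst_inl_add_snd_inr, D.one_comp]

/-- The functoriality of cones for commutative squares of closed morphisms. -/
lemma exists_map {a' b' c' : D.Ob} {f' : (D.Hom a' b').X 0} (C' : D.ConeData f' c')
    (m : (D.Hom a a').X 0) (n : (D.Hom b b').X 0) (hm : (D.Hom a a').d 0 1 m = 0)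
    (hn : (D.Hom b b').d 0 1 n = 0)
    (h : D.comp (add_zero 0) f n = D.comp (add_zero 0) m f') :
    ∃ g : (D.Hom c c').X 0, (D.Hom c c').d 0 1 g = 0 ∧
      D.comp (add_zero (-1)) C.inl g = D.comp (zero_add (-1)) m C'.inl ∧
      D.comp (add_zero 0) C.inr g = D.comp (add_zero 0) n C'.inr ∧
      D.comp (add_zero 0) g C'.snd = D.comp (add_zero 0) C.snd n := by
  refine ⟨D.comp (show (1 : ℤ) + -1 = 0 by norm_num) (D.comp (add_zero 1) C.fst m) C'.inl +
    D.comp (add_zero 0) (D.comp (add_zero 0) C.snd n) C'.inr, ?_, ?_, ?_, ?_⟩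
  · rw [map_add, C'.d_comp_inl _ (show (1 : ℤ) + 1 = 2 by norm_num), C'.d_comp_inr (zero_add 1),
      D.d_comp_of_d_eq_zero (add_zero 1) (show (1 : ℤ) + 1 = 2 by norm_num) (zero_add 1)
        (show (1 : ℤ) + 1 = 2 by norm_num) C.d_fst, hm,
      D.d_comp_of_d_eq_zero' (add_zero 0) (zero_add 1) (zero_add 1) (zero_add 1) _ hn, C.d_snd,
      D.assoc (add_zero 1) (add_zero 0) (add_zero 1) (add_zero 1) C.fst m f', ← h,
      ← D.assoc (add_zero 1) (add_zero 0) (add_zero 1) (add_zero 1)]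
    simp
  · rw [map_add, ← D.assoc (show -1 + 1 = (0 : ℤ) by norm_num) (show (1 : ℤ) + -1 = 0 by norm_num)
      (zero_add (-1)) (add_zero (-1)),
      ← D.assoc (show -1 + 1 = (0 : ℤ) by norm_num) (add_zero 1) (zero_add 0) (by norm_num),
      C.inl_fst, D.one_comp, ← D.assoc (add_zero (-1)) (add_zero 0) (add_zero (-1)) (add_zero (-1)),
      ← D.assoc (add_zero (-1)) (add_zero 0) (add_zero (-1)) (add_zero (-1)), C.inl_snd]
    simp
  · rw [map_add, ← D.assoc (zero_add 1) (show (1 : ℤ) + -1 = 0 by norm_num)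
      (show (1 : ℤ) + -1 = 0 by norm_num) (add_zero 0),
      ← D.assoc (zero_add 1) (add_zero 1) (add_zero 1) (zero_add 1), C.inr_fst,
      ← D.assoc (add_zero 0) (add_zero 0) (add_zero 0) (add_zero 0),
      ← D.assoc (add_zero 0) (add_zero 0) (add_zero 0) (add_zero 0), C.inr_snd, D.one_comp]
    simp
  · rw [map_add, LinearMap.add_apply, C'.comp_inl_snd, C'.comp_inr_snd, zero_add]

end ConeData

end DGCat

namespace DGModule

variable {T : DGCat.{u} k}

/-- A module is acyclic if its complexes are exact. -/
def IsAcyclic (K : DGModule T) : Prop :=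
  ∀ (x : T.Ob) (m n : ℤ), m + 1 = n → ∀ y : (K.cx x).X n, (K.cx x).d n (n + 1) y = 0 →
    ∃ w : (K.cx x).X m, y = (K.cx x).d m n w

/-- Any morphism between acyclic modules is a weak equivalence. -/
lemma IsAcyclic.isWeakEquiv {K L : DGModule T} (hK : K.IsAcyclic) (hL : L.IsAcyclic)
    (φ : K ⟶ L) : IsWeakEquiv φ := fun x =>
  (CochainComplex.quasiIso_iff_elements _).2 fun m n h =>
    ⟨fun y hy => ⟨0, map_zero _, by
      obtain ⟨w, rfl⟩ := hL x m n h y hy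
      exact ⟨w, by rw [map_zero, zero_add]⟩⟩, fun y hy _ _ => hK x m n h y hy⟩

lemma IsWeakEquiv.isAcyclic_cofiber {M N : DGModule T} {φ : M ⟶ N} (hφ : IsWeakEquiv φ) :
    (cofiber φ).IsAcyclic := by
  intro x m n h t ht
  obtain ⟨hs, -⟩ := (CochainComplex.quasiIso_iff_elements _).1 (hφ x) m n h
  obtain ⟨-, hi⟩ := (CochainComplex.quasiIso_iff_elements _).1 (hφ x) n (n + 1) rfl
  have h₁ : (M.cx x).d (n + 1) (n + 1 + 1) (cofiberFst φ x rfl t) = 0 := by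
    rw [← neg_eq_zero, ← cofiberFst_d φ x rfl rfl, ht, map_zero]
  have h₂ : (Hom.app φ x).f (n + 1) (cofiberFst φ x rfl t) +
      (N.cx x).d n (n + 1) (cofiberSnd φ x n t) = 0 := by
    rw [← cofiberSnd_d, ht, map_zero]
  obtain ⟨v, hv⟩ := hi _ h₁ (-cofiberSnd φ x n t) (by
    rw [map_neg]
    exact eq_neg_of_add_eq_zero_left h₂)
  obtain ⟨y, hy, w, hw⟩ := hs ((Hom.app φ x).f n v + cofiberSnd φ x n t) (by
    rw [map_add, ← CochainComplex.f_d_apply, ← hv, h₂])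
  obtain ⟨s, hs₁, hs₂⟩ := cofiber_exists φ x h (y - v) w
  refine ⟨s, cofiber_ext (rfl : n + 1 = n + 1) ?_ ?_⟩
  · rw [cofiberFst_d φ x h rfl, hs₁, map_sub, hy, hv]
    abel
  · rw [cofiberSnd_d φ x h, hs₁, hs₂, map_sub]
    rw [← sub_eq_zero] at hw ⊢
    rw [← hw]
    abel

lemma isWeakEquiv_id (M : DGModule T) : IsWeakEquiv (𝟙 M) := fun x =>
  CochainComplex.quasiIso_of_bijective (𝟙 (M.cx x)) fun _ => Function.bijective_id

lemma natOfHom_id (M : DGModule T) : natOfHom (𝟙 M) = T.modules.one M := rfl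

lemma IsAcyclic.of_isoOfDegree {M N : DGModule T} {n : ℤ} (e : T.modules.IsoOfDegree M N n)
    (hN : N.IsAcyclic) : M.IsAcyclic := by
  intro x p q h y hy
  obtain ⟨w, hw⟩ := hN x (p + n) (q + n) (by omega) (eval x rfl e.hom y) (by
    rw [d_eval x rfl rfl rfl rfl, e.d_hom, show (M.cx x).d q (q + 1) y = 0 from hy]
    simp only [map_zero, LinearMap.zero_apply, smul_zero, add_zero])
  have h₁ : eval x (show q + n + -n = q by omega) e.inv (eval x rfl e.hom y) = y := by
    rw [← eval_comp x rfl _ (add_neg_cancel n) (add_zero q), e.hom_inv_id, eval_one]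
  refine ⟨(-n).negOnePow • eval x (show p + n + -n = p by omega) e.inv w, ?_⟩
  rw [ModuleCat.hom_negOnePow_smul, d_eval x (show p + n + -n = p by omega) rfl
    (show p + n + 1 = q + n by omega) h, e.d_inv, ← hw, map_zero, LinearMap.zero_apply, zero_add,
    negOnePow_smul_smul, negOnePow_smul_congr (b := 0) ⟨-n, by ring⟩, Int.negOnePow_zero, one_smul]
  exact h₁.symm

/-- A module `M` is dg projective if it is projective as a graded module, that is, if dg natural
transformations of any degree out of `M`, closed or not, lift along pointwise surjections, and if
the complexes of morphisms from `M` to acyclic modules are acyclic. -/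
structure IsDGProjective (M : DGModule T) : Prop where
  exists_lift : ∀ {P Q : DGModule T} (ψ : P ⟶ Q), IsFibration ψ → ∀ (n : ℤ)
    (α : (T.modules.Hom M Q).X n), ∃ β : (T.modules.Hom M P).X n,
      T.modules.comp (add_zero n) β (natOfHom ψ) = α
  exists_d_eq : ∀ {K : DGModule T}, K.IsAcyclic → ∀ (m n : ℤ), m + 1 = n →
    ∀ α : (T.modules.Hom M K).X n, (T.modules.Hom M K).d n (n + 1) α = 0 →
      ∃ β : (T.modules.Hom M K).X m, (T.modules.Hom M K).d m n β = α

lemma zero_hom_ext {M : DGModule T} (φ ψ : zero T ⟶ M) : φ = ψ :=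
  hom_ext_elements fun x p z => by
    rw [zero_cx_eq_zero z]
    exact (map_zero _).trans (map_zero _).symm

lemma isCofibrant_iff_exists_lift (M : DGModule T) :
    M.IsCofibrant ↔ ∀ ⦃P Q : DGModule T⦄ (ψ : P ⟶ Q), IsFibration ψ → IsWeakEquiv ψ →
      ∀ φ : M ⟶ Q, ∃ l : M ⟶ P, l ≫ ψ = φ := by
  constructor
  · intro hM P Q ψ h₁ h₂ φ
    have := hM ψ h₁ h₂
    have sq : CommSq (Hom.mk (fun _ => 0) (by simp) : zero T ⟶ P)
      (Hom.mk (fun _ => 0) (by simp) : zero T ⟶ M) ψ φ :=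
      ⟨zero_hom_ext _ _⟩
    exact ⟨sq.lift, sq.fac_right⟩
  · intro hM P Q ψ h₁ h₂
    refine ⟨fun {f g} sq => ?_⟩
    obtain ⟨l, hl⟩ := hM ψ h₁ h₂ g
    exact ⟨⟨⟨l, zero_hom_ext _ _, hl⟩⟩⟩

/-- Graded lifts along pointwise surjections: a dg natural transformation `α : M ⟶ Q` of degree `0`
corresponds to the closed one `d (α ; inl)` with values in the cone of the identity of `Q`, and the
latter can be lifted since a pointwise surjection induces a trivial fibration between cones of
identities. -/
lemma IsCofibrant.exists_lift_zero {M : DGModule T} (hM : M.IsCofibrant) {P Q : DGModule T}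
    (ψ : P ⟶ Q) (hψ : IsFibration ψ) (α : (T.modules.Hom M Q).X 0) :
    ∃ β : (T.modules.Hom M P).X 0, T.modules.comp (add_zero 0) β (natOfHom ψ) = α := by
  let C := cofiberConeData (𝟙 P)
  let C' := cofiberConeData (𝟙 Q)
  obtain ⟨g, hg, h₁, h₂, h₃⟩ := C.exists_map C' (natOfHom ψ) (natOfHom ψ) (d_natOfHom ψ)
    (d_natOfHom ψ) (by rw [natOfHom_id, natOfHom_id, T.modules.one_comp, T.modules.comp_one])
  have hfib : IsFibration (homOfNat g hg) := by
    intro x n t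
    obtain ⟨a, ha⟩ := hψ x (n + 1) (eval x rfl C'.fst t)
    obtain ⟨b, hb⟩ := hψ x n (eval x (add_zero n) C'.snd t)
    rw [← eval_natOfHom] at ha hb
    refine ⟨eval x (show n + 1 + -1 = n by omega) C.inl a + eval x (add_zero n) C.inr b, ?_⟩
    rw [homOfNat_apply, map_add,
      ← eval_comp x (show n + 1 + -1 = n by omega) (add_zero n) (add_zero (-1)) (by omega), h₁,
      ← eval_comp x (add_zero n) (add_zero n) (add_zero 0) (add_zero n), h₂,
      eval_comp x (add_zero (n + 1)) (show n + 1 + -1 = n by omega) (zero_add (-1)), ha,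
      eval_comp x (add_zero n) (add_zero n) (add_zero 0), hb,
      ← eval_comp x rfl (show n + 1 + -1 = n by omega) (add_neg_cancel 1) (add_zero n),
      ← eval_comp x (add_zero n) (add_zero n) (add_zero 0) (add_zero n), ← LinearMap.add_apply,
      ← map_add, C'.fst_inl_add_snd_inr, eval_one]
  have hweq : IsWeakEquiv (homOfNat g hg) :=
    (isWeakEquiv_id P).isAcyclic_cofiber.isWeakEquiv (isWeakEquiv_id Q).isAcyclic_cofiber _
  obtain ⟨l, hl⟩ := (isCofibrant_iff_exists_lift M).1 hM _ hfib hweq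
    (homOfNat ((T.modules.Hom M (cofiber (𝟙 Q))).d (-1) 0
      (T.modules.comp (zero_add (-1)) α C'.inl)) (T.modules.d_d_apply _ _ _ _))
  have hl' := congrArg natOfHom hl
  rw [natOfHom_comp, natOfHom_homOfNat, natOfHom_homOfNat] at hl'
  refine ⟨T.modules.comp (add_zero 0) (natOfHom l) C.snd, ?_⟩
  rw [T.modules.assoc (add_zero 0) (add_zero 0) (add_zero 0) (add_zero 0), ← h₃,
    ← T.modules.assoc (add_zero 0) (add_zero 0) (add_zero 0) (add_zero 0), hl',
    C'.d_comp_inl (zero_add (-1)) (zero_add 1), map_sub, LinearMap.sub_apply, C'.comp_inr_snd,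
    C'.comp_inl_snd, sub_zero, natOfHom_id, T.modules.comp_one]

/-- Lifts of degree `n` reduce to lifts of degree `0` by shifting the target, and closed dg natural
transformations to an acyclic module `K` are boundaries since they lift to the cone of the identity
of a shift of `K`. -/
lemma IsCofibrant.isDGProjective {M : DGModule T} (hM : M.IsCofibrant) : M.IsDGProjective where
  exists_lift {P Q} ψ hψ n α := by
    let eP := shiftIso P n
    let eQ := shiftIso Q n
    obtain ⟨g, hgdef⟩ : ∃ g : (T.modules.Hom (P.shift n) (Q.shift n)).X 0, g =
      T.modules.comp (add_neg_cancel n) (T.modules.comp (add_zero n) eP.hom (natOfHom ψ)) eQ.inv :=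
      ⟨_, rfl⟩
    have hg : (T.modules.Hom (P.shift n) (Q.shift n)).d 0 1 g = 0 := by
      rw [hgdef, T.modules.d_comp_of_d_eq_zero' (add_neg_cancel n) rfl rfl (zero_add 1) _ eQ.d_inv,
        T.modules.d_comp_of_d_eq_zero (add_zero n) rfl (zero_add 1) rfl eP.d_hom, d_natOfHom,
        map_zero, map_zero, LinearMap.zero_apply, smul_zero]
    have hfib : IsFibration (homOfNat g hg) := by
      intro x p t
      obtain ⟨a, ha⟩ := hψ x (p + n) (eval x rfl eQ.hom t)
      rw [← eval_natOfHom] at ha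
      refine ⟨eval x (show p + n + -n = p by omega) eP.inv a, ?_⟩
      rw [homOfNat_apply, ← eval_comp x (show p + n + -n = p by omega) (add_zero p) (add_zero (-n))
        (show p + n + -n = p by omega), hgdef,
        T.modules.assoc (add_zero n) (zero_add (-n)) (add_neg_cancel n) (add_neg_cancel n),
        eP.inv_hom_comp (add_neg_cancel n) (add_zero (-n)),
        eval_comp x (add_zero (p + n)) (show p + n + -n = p by omega) (zero_add (-n)), ha,
        ← eval_comp x rfl _ (add_neg_cancel n) (add_zero p), eQ.hom_inv_id, eval_one]
    obtain ⟨β, hβ⟩ := hM.exists_lift_zero _ hfib (T.modules.comp (add_neg_cancel n) α eQ.inv)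
    rw [natOfHom_homOfNat] at hβ
    refine ⟨T.modules.comp (zero_add n) β eP.hom, ?_⟩
    apply eQ.comp_inv_injective (add_neg_cancel n)
    rw [← hβ, hgdef, T.modules.assoc (zero_add n) (add_zero n) (add_zero n) (zero_add n),
      T.modules.assoc (zero_add n) (add_neg_cancel n) (add_neg_cancel n) (zero_add 0)]
  exists_d_eq {K} hK m n h α hα := by
    -- on the cone `C` of the identity of the shift `K[m]`, the first projection gives a trivial
    -- fibration `π` to `K[n]`, and a closed lift `l` of `α` along `π` satisfies
    -- `d (l ; snd) = -(l ; fst)`, so that its second component bounds `α` up to sign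
    let e := shiftIso K m
    let e' := shiftIso K n
    let C : T.modules.ConeData (T.modules.one (K.shift m)) (cofiber (𝟙 (K.shift m))) :=
      cofiberConeData (𝟙 (K.shift m))
    have hC : (cofiber (𝟙 (K.shift m))).IsAcyclic := (isWeakEquiv_id _).isAcyclic_cofiber
    obtain ⟨π, hπ⟩ : ∃ π : (T.modules.Hom (cofiber (𝟙 (K.shift m))) (K.shift n)).X 0, π =
        T.modules.comp (add_neg_cancel n)
          (T.modules.comp (show 1 + m = n by omega) C.fst e.hom) e'.inv := ⟨_, rfl⟩
    have hπd : (T.modules.Hom (cofiber (𝟙 (K.shift m))) (K.shift n)).d 0 1 π = 0 := by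
      rw [hπ, T.modules.d_comp_of_d_eq_zero' (add_neg_cancel n) rfl rfl (zero_add 1) _ e'.d_inv,
        T.modules.d_comp_of_d_eq_zero (show 1 + m = n by omega) (show (1 : ℤ) + 1 = 2 by norm_num)
          rfl rfl C.d_fst, e.d_hom, map_zero, map_zero, LinearMap.zero_apply, smul_zero]
    have hfib : IsFibration (homOfNat π hπd) := by
      intro x p t
      refine ⟨eval x (show p + 1 + -1 = p by omega) C.inl (eval x (show p + n + -m = p + 1 by omega)
        e.inv (eval x rfl e'.hom t)), ?_⟩
      rw [homOfNat_apply, hπ,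
        ← eval_comp x (show p + 1 + -1 = p by omega) (add_zero p) (add_zero (-1)) (by omega),
        ← T.modules.assoc (show -1 + n = m by omega) (add_neg_cancel n) (by omega) (add_zero (-1)),
        ← T.modules.assoc (neg_add_cancel 1) (show 1 + m = n by omega) (zero_add m) (by omega),
        C.inl_fst, T.modules.one_comp,
        ← eval_comp x (show p + n + -m = p + 1 by omega) (show p + 1 + -1 = p by omega)
          (show -m + -1 = -n by omega) (by omega),
        ← T.modules.assoc (neg_add_cancel m) (show m + -n = -1 by omega) (zero_add (-n)) (by omega),
        e.inv_hom_id, T.modules.one_comp, ← eval_comp x rfl _ (add_neg_cancel n) (add_zero p),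
        e'.hom_inv_id, eval_one]
    obtain ⟨l, hl⟩ := (isCofibrant_iff_exists_lift M).1 hM _ hfib
      (hC.isWeakEquiv (hK.of_isoOfDegree e') _)
      (homOfNat (T.modules.comp (add_neg_cancel n) α e'.inv) (by
        rw [T.modules.d_comp_of_d_eq_zero' (add_neg_cancel n) rfl rfl (zero_add 1) _ e'.d_inv, hα,
          map_zero, LinearMap.zero_apply, smul_zero]))
    have hl' := congrArg natOfHom hl
    rw [natOfHom_comp, natOfHom_homOfNat, natOfHom_homOfNat, hπ,
      ← T.modules.assoc (zero_add n) (add_neg_cancel n) (add_neg_cancel n) (zero_add 0)] at hl'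
    have hα' : T.modules.comp (zero_add n) (natOfHom l)
        (T.modules.comp (show 1 + m = n by omega) C.fst e.hom) = α :=
      e'.comp_inv_injective (add_neg_cancel n) hl'
    refine ⟨-(m.negOnePow • T.modules.comp (zero_add m) (T.modules.comp (zero_add 0) (natOfHom l)
      C.snd) e.hom), ?_⟩
    rw [map_neg, ModuleCat.hom_negOnePow_smul,
      T.modules.d_comp_of_d_eq_zero' (zero_add m) (zero_add 1) rfl h _ e.d_hom,
      T.modules.d_comp_of_d_eq_zero (zero_add 0) (zero_add 1) (zero_add 1) (zero_add 1)
        (d_natOfHom l), C.d_snd, T.modules.comp_one, negOnePow_smul_smul,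
      negOnePow_smul_congr (b := 0) ⟨m, by ring⟩, Int.negOnePow_zero, one_smul, map_neg, map_neg,
      LinearMap.neg_apply, neg_neg, ← hα',
      T.modules.assoc (zero_add 1) (show 1 + m = n by omega) (show 1 + m = n by omega) (zero_add n)]

end DGModule

end Cofibrant

/-! ### Dg projective modules are cofibrant; closure properties -/

section DGProjective

variable {k : Type u} [Field k]

namespace DGModule

variable {T : DGCat.{u} k}

/-- A morphism from a dg projective module lifts along a trivial fibration `ψ` up to homotopy since
the cofiber of `ψ` is acyclic, and then strictly since the homotopy lifts. -/
lemma IsDGProjective.isCofibrant {M : DGModule T} (hM : M.IsDGProjective) : M.IsCofibrant := by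
  rw [isCofibrant_iff_exists_lift]
  intro P Q ψ h₁ h₂ φ
  let C := cofiberConeData ψ
  -- the composition of `φ` with the inclusion into the acyclic cofiber is the boundary of some `γ`,
  -- and `γ ; fst : M ⟶ P` is a lift of `φ` up to the homotopy `γ ; snd`
  obtain ⟨γ, hγ⟩ := hM.exists_d_eq h₂.isAcyclic_cofiber (-1) 0 (by norm_num)
    (T.modules.comp (add_zero 0) (natOfHom φ) C.inr) (by
      refine (T.modules.d_comp_of_d_eq_zero (add_zero 0) rfl rfl rfl (d_natOfHom φ) C.inr).trans ?_
      exact (congrArg _ C.d_inr).trans (map_zero _))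
  obtain ⟨h, hh⟩ := hM.exists_lift ψ h₁ (-1) (T.modules.comp (add_zero (-1)) γ C.snd)
  have hg : (T.modules.Hom M P).d 0 1 (T.modules.comp (show (-1 : ℤ) + 1 = 0 by norm_num) γ C.fst) =
      0 := by
    rw [T.modules.d_comp_of_d_eq_zero' _ (show (-1 : ℤ) + 1 = 0 by norm_num)
      (show (1 : ℤ) + 1 = 2 by norm_num) (zero_add 1) _ C.d_fst, hγ, C.comp_inr_fst, smul_zero]
  -- the homotopy is lifted to `h`, and `d h` corrects `γ ; fst` to a strict lift
  have hl : (T.modules.Hom M P).d 0 1 (T.modules.comp (show (-1 : ℤ) + 1 = 0 by norm_num) γ C.fst +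
      (T.modules.Hom M P).d (-1) 0 h) = 0 := by
    rw [map_add, hg, T.modules.d_d_apply, add_zero]
  refine ⟨homOfNat _ hl, hom_ext_elements fun x p z => ?_⟩
  have key : T.modules.comp (add_zero 0) (natOfHom (homOfNat _ hl)) (natOfHom ψ) = natOfHom φ := by
    have hd := T.modules.d_comp_of_d_eq_zero' (add_zero (-1)) (show (-1 : ℤ) + 1 = 0 by norm_num)
      (zero_add 1) (show (-1 : ℤ) + 1 = 0 by norm_num) h (d_natOfHom ψ)
    rw [Int.negOnePow_zero, one_smul, hh, T.modules.d_comp' (add_zero (-1))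
      (show (-1 : ℤ) + 1 = 0 by norm_num) (zero_add 1) (show (-1 : ℤ) + 1 = 0 by norm_num), hγ,
      C.comp_inr_snd, C.d_snd, Int.negOnePow_zero, one_smul, map_neg] at hd
    rw [natOfHom_homOfNat, map_add, LinearMap.add_apply, ← hd,
      T.modules.assoc (show (-1 : ℤ) + 1 = 0 by norm_num) (add_zero 1) (add_zero 0) (by norm_num)]
    abel
  rw [← natOfHom_comp] at key
  rw [← eval_natOfHom, key, eval_natOfHom]

lemma IsDGProjective.of_isoOfDegree {M N : DGModule T} {a : ℤ} (e : T.modules.IsoOfDegree M N a)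
    (hN : N.IsDGProjective) : M.IsDGProjective where
  exists_lift ψ hψ n α := by
    obtain ⟨β, hβ⟩ := hN.exists_lift ψ hψ (-a + n) (T.modules.comp rfl e.inv α)
    refine ⟨T.modules.comp (show a + (-a + n) = n by omega) e.hom β, ?_⟩
    rw [T.modules.assoc (show a + (-a + n) = n by omega) (add_zero (-a + n)) (add_zero n)
      (show a + (-a + n) = n by omega), hβ, e.hom_inv_comp]
  exists_d_eq hK m n h α hα := by
    obtain ⟨β, hβ⟩ := hN.exists_d_eq hK (-a + m) (-a + n) (by omega)
      (T.modules.comp rfl e.inv α) (by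
      rw [T.modules.d_comp_of_d_eq_zero rfl rfl rfl rfl e.d_inv, hα, map_zero])
    refine ⟨T.modules.comp (show a + (-a + m) = m by omega) e.hom β, ?_⟩
    rw [T.modules.d_comp_of_d_eq_zero (show a + (-a + m) = m by omega) rfl
      (show -a + m + 1 = -a + n by omega) h e.d_hom, hβ, e.hom_inv_comp]

lemma IsDGProjective.of_coneData {M N P : DGModule T} {f : (T.modules.Hom M N).X 0}
    (C : T.modules.ConeData f P) (hM : M.IsDGProjective) (hN : N.IsDGProjective) :
    P.IsDGProjective where
  exists_lift ψ hψ n α := by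
    obtain ⟨β, hβ⟩ := hM.exists_lift ψ hψ (-1 + n) (T.modules.comp rfl C.inl α)
    obtain ⟨γ, hγ⟩ := hN.exists_lift ψ hψ n (T.modules.comp (zero_add n) C.inr α)
    refine ⟨T.modules.comp (show 1 + (-1 + n) = n by omega) C.fst β +
      T.modules.comp (zero_add n) C.snd γ, ?_⟩
    rw [map_add, LinearMap.add_apply, T.modules.assoc (show 1 + (-1 + n) = n by omega)
      (add_zero (-1 + n)) (add_zero n) (show 1 + (-1 + n) = n by omega), hβ,
      T.modules.assoc (zero_add n) (add_zero n) (add_zero n) (zero_add n), hγ, C.decomp_from]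
  exists_d_eq {K} hK m n h α hα := by
    obtain ⟨β, hβ⟩ := hN.exists_d_eq hK m n h (T.modules.comp (zero_add n) C.inr α) (by
      rw [T.modules.d_comp_of_d_eq_zero (zero_add n) (zero_add 1) rfl rfl C.d_inr, hα, map_zero])
    -- subtracting a boundary, the restriction of `α` to the second summand becomes zero
    obtain ⟨α', hα'⟩ : ∃ α' : (T.modules.Hom P K).X n, α' =
      α - (T.modules.Hom P K).d m n (T.modules.comp (zero_add m) C.snd β) := ⟨_, rfl⟩
    have hd : (T.modules.Hom P K).d n (n + 1) α' = 0 := by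
      rw [hα', map_sub, hα, T.modules.d_d_apply, sub_zero]
    have hr : T.modules.comp (zero_add n) C.inr α' = 0 := by
      rw [hα', map_sub, ← T.modules.d_comp_of_d_eq_zero (zero_add m) (zero_add 1) h h C.d_inr,
        ← T.modules.assoc (add_zero 0) (zero_add m) (zero_add m) (zero_add m), C.inr_snd,
        T.modules.one_comp, hβ, sub_self]
    obtain ⟨γ, hγ⟩ := hM.exists_d_eq hK (m - 1) m (by omega)
      (T.modules.comp (show -1 + n = m by omega) C.inl α') (by
        rw [T.modules.d_comp' (show -1 + n = m by omega) (show (-1 : ℤ) + 1 = 0 by norm_num) rfl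
          rfl, hd, C.d_inl, T.modules.assoc (add_zero 0) (zero_add n) (by omega) (by omega), hr,
          map_zero, map_zero, smul_zero, add_zero])
    refine ⟨T.modules.comp (zero_add m) C.snd β +
      T.modules.comp (show 1 + (m - 1) = m by omega) C.fst γ, ?_⟩
    have hdec := C.decomp_from (show -1 + n = m by omega) α'
    rw [hr, map_zero, add_zero, ← hγ, ← T.modules.d_comp_of_d_eq_zero
      (show 1 + (m - 1) = m by omega) (show (1 : ℤ) + 1 = 2 by norm_num) (by omega) h C.d_fst,
      hα'] at hdec
    rw [map_add, hdec]
    abel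

/-- The dg natural transformation of degree `n` from a representable module that corresponds to an
element of degree `n` by the Yoneda lemma. -/
def yonedaNat (M : DGModule T) {a : T.Ob} {n : ℤ} (z : (M.cx a).X n) :
    (T.modules.Hom (representable a) M).X n :=
  mkNat (fun x => Cochain.mk fun p q h => ModuleCat.ofHom
    ((signSMul (k := k) _ (n * p)).comp ((M.smul (show n + p = q by omega)).flip z)))
    fun x y p m h h' f => by
      ext r s hs : 1
      rw [Cochain.comp_v _ _ _ r (r + p) s rfl (by omega), Cochain.units_smul_v,
        Cochain.comp_v _ _ _ r (r + n) s rfl (by omega)]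
      refine ModuleCat.hom_ext (LinearMap.ext fun (g : (T.Hom x a).X r) => ?_)
      change (n * (r + p)).negOnePow • M.smul (show n + (r + p) = s by omega)
        ((p * r).negOnePow • T.comp (show p + r = r + p by omega) f g) z =
        (n * p).negOnePow • M.smul (show r + n + p = s by omega) f ((n * r).negOnePow •
          M.smul (show n + r = r + n by omega) g z)
      rw [map_negOnePow_smul₂, map_negOnePow_smul, M.smul_smul' _ _ (show p + r = r + p by omega)
        (show n + (r + p) = s by omega), negOnePow_smul_smul, negOnePow_smul_smul,
        negOnePow_smul_smul]
      exact negOnePow_smul_congr ⟨0, by ring⟩ _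

lemma eval_yonedaNat (M : DGModule T) {a : T.Ob} {n : ℤ} (z : (M.cx a).X n) {x : T.Ob} {p q : ℤ}
    (h : p + n = q) (g : (T.Hom x a).X p) :
    eval x h (M.yonedaNat z) g = (n * p).negOnePow • M.smul (show n + p = q by omega) g z := rfl

lemma eval_yonedaNat_one (M : DGModule T) {a : T.Ob} {n : ℤ} (z : (M.cx a).X n) :
    eval a (zero_add n) (M.yonedaNat z) (T.one a) = z := by
  refine (M.eval_yonedaNat z (zero_add n) (T.one a)).trans ?_
  rw [mul_zero, Int.negOnePow_zero, one_smul, M.one_smul']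

/-- The uniqueness part of the Yoneda lemma: a dg natural transformation out of a representable
module is determined by its value at the identity. -/
lemma yoneda_ext {M : DGModule T} {a : T.Ob} {n : ℤ}
    {α β : (T.modules.Hom (representable a) M).X n}
    (h : eval a (zero_add n) α (T.one a : ((representable a).cx a).X 0) =
      eval a (zero_add n) β (T.one a : ((representable a).cx a).X 0)) : α = β := by
  refine nat_ext fun x p q hpq (g : (T.Hom x a).X p) => ?_
  have hg : (representable a).smul (zero_add p) g (T.one a : ((representable a).cx a).X 0) = g := by
    refine (representable_smul a (zero_add p) g (T.one a)).trans ?_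
    rw [mul_zero, Int.negOnePow_zero, one_smul]
    exact T.comp_one g
  have key (γ : (T.modules.Hom (representable a) M).X n) : eval x hpq γ g =
      (n * p).negOnePow • M.smul (show n + p = q by omega) g
        (eval a (zero_add n) γ (T.one a : ((representable a).cx a).X 0)) :=
    (congrArg (eval x hpq γ) hg.symm).trans (eval_smul (zero_add p) hpq (zero_add n) _ γ g _)
  exact (key α).trans ((congrArg _ (congrArg _ h)).trans (key β).symm)

lemma d_yonedaNat (M : DGModule T) {a : T.Ob} {m n : ℤ} (h : m + 1 = n) (z : (M.cx a).X m) :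
    (T.modules.Hom (representable a) M).d m n (M.yonedaNat z) =
      M.yonedaNat ((M.cx a).d m n z) := by
  refine yoneda_ext ?_
  have h₁ := d_eval a (zero_add m) h (zero_add 1) h (M.yonedaNat z) (T.one a)
  have h₂ : ((representable a).cx a).d 0 1 (T.one a) = 0 := T.d_one a
  rw [h₂, map_zero, smul_zero, add_zero] at h₁
  refine h₁.symm.trans ((congrArg _ (M.eval_yonedaNat_one z)).trans ?_)
  exact (M.eval_yonedaNat_one _).symm

/-- By the Yoneda lemma, lifts and boundaries of dg natural transformations out of the module
represented by `a` are lifts and boundaries of elements at `a`. -/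
lemma isDGProjective_representable (a : T.Ob) : (representable a).IsDGProjective where
  exists_lift {P Q} ψ hψ n α := by
    obtain ⟨z, hz⟩ := hψ a n (eval a (zero_add n) α (T.one a : ((representable a).cx a).X 0))
    refine ⟨P.yonedaNat z, yoneda_ext ?_⟩
    refine (eval_comp a (zero_add n) (add_zero n) (add_zero n) (zero_add n) _ _ _).trans ?_
    rw [← hz, eval_natOfHom]
    exact congrArg _ (P.eval_yonedaNat_one z)
  exists_d_eq {K} hK m n h α hα := by
    obtain ⟨w, hw⟩ := hK a m n h
      (eval a (zero_add n) α (T.one a : ((representable a).cx a).X 0)) (by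
        have h₁ := d_eval a (zero_add n) rfl (zero_add 1) rfl α (T.one a)
        have h₂ : ((representable a).cx a).d 0 1 (T.one a) = 0 := T.d_one a
        rw [h₂, hα, map_zero, map_zero, smul_zero, add_zero] at h₁
        exact h₁)
    refine ⟨K.yonedaNat w, (K.d_yonedaNat h w).trans (yoneda_ext ?_)⟩
    exact (K.eval_yonedaNat_one _).trans hw.symm

end DGModule

end DGProjective

/-! ### Isomorphic copies inside a full dg subcategory -/

section Transport

variable {k : Type u} [Field k]

namespace DGCat

variable {D : DGCat.{w} k}

namespace IsoOfDegree

/-- A cone on `c` gives a cone on any object isomorphic to `c`. -/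
def coneData {a b c c' : D.Ob} {f : (D.Hom a b).X 0} (C : D.ConeData f c)
    (e : D.IsoOfDegree c' c 0) : D.ConeData f c' where
  inl := D.comp (add_zero (-1)) C.inl (e.inv : (D.Hom c c').X 0)
  inr := D.comp (add_zero 0) C.inr (e.inv : (D.Hom c c').X 0)
  fst := D.comp (zero_add 1) e.hom C.fst
  snd := D.comp (add_zero 0) e.hom C.snd
  d_inl := by
    have hd : (D.Hom c c').d 0 1 (e.inv : (D.Hom c c').X 0) = 0 := e.d_inv
    rw [D.d_comp_of_d_eq_zero' (add_zero (-1)) (show (-1 : ℤ) + 1 = 0 by norm_num) (zero_add 1)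
      (show (-1 : ℤ) + 1 = 0 by norm_num) C.inl hd, C.d_inl, Int.negOnePow_zero, one_smul,
      D.assoc (add_zero 0) (add_zero 0) (add_zero 0) (add_zero 0)]
  d_inr := by
    have hd : (D.Hom c c').d 0 1 (e.inv : (D.Hom c c').X 0) = 0 := e.d_inv
    rw [D.d_comp_of_d_eq_zero (add_zero 0) (zero_add 1) (zero_add 1) (zero_add 1) C.d_inr, hd,
      map_zero]
  d_fst := by
    have hd : (D.Hom c' c).d 0 1 e.hom = 0 := e.d_hom
    rw [D.d_comp_of_d_eq_zero (zero_add 1) (zero_add 1) (show (1 : ℤ) + 1 = 2 by norm_num)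
      (show (1 : ℤ) + 1 = 2 by norm_num) hd, C.d_fst, map_zero]
  d_snd := by
    have hd : (D.Hom c' c).d 0 1 e.hom = 0 := e.d_hom
    rw [D.d_comp_of_d_eq_zero (add_zero 0) (zero_add 1) (zero_add 1) (zero_add 1) hd, C.d_snd,
      map_neg, D.assoc (zero_add 1) (add_zero 1) (add_zero 1) (zero_add 1)]
  inl_fst := by
    have h : D.comp (zero_add 1) (e.inv : (D.Hom c c').X 0) (D.comp (zero_add 1) e.hom C.fst) =
      C.fst := e.inv_hom_comp (zero_add 1) (zero_add 1) C.fst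
    rw [D.assoc (add_zero (-1)) (zero_add 1) (neg_add_cancel 1) (neg_add_cancel 1), h, C.inl_fst]
  inl_snd := by
    have h : D.comp (zero_add 0) (e.inv : (D.Hom c c').X 0) (D.comp (add_zero 0) e.hom C.snd) =
      C.snd := e.inv_hom_comp (zero_add 0) (zero_add 0) C.snd
    rw [D.assoc (add_zero (-1)) (zero_add 0) (add_zero (-1)) (add_zero (-1)), h, C.inl_snd]
  inr_fst := by
    have h : D.comp (zero_add 1) (e.inv : (D.Hom c c').X 0) (D.comp (zero_add 1) e.hom C.fst) =
      C.fst := e.inv_hom_comp (zero_add 1) (zero_add 1) C.fst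
    rw [D.assoc (add_zero 0) (zero_add 1) (zero_add 1) (zero_add 1), h, C.inr_fst]
  inr_snd := by
    have h : D.comp (zero_add 0) (e.inv : (D.Hom c c').X 0) (D.comp (add_zero 0) e.hom C.snd) =
      C.snd := e.inv_hom_comp (zero_add 0) (zero_add 0) C.snd
    rw [D.assoc (add_zero 0) (zero_add 0) (add_zero 0) (add_zero 0), h, C.inr_snd]
  fst_inl_add_snd_inr := by
    have h : D.comp (add_zero 0) e.hom (e.inv : (D.Hom c c').X 0) = D.one c' := e.hom_inv_id
    rw [D.assoc (zero_add 1) (show (1 : ℤ) + -1 = 0 by norm_num) (add_neg_cancel 1) (add_zero 0),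
      ← D.assoc (add_neg_cancel 1) (add_zero (-1)) (add_zero 0) (add_neg_cancel 1),
      D.assoc (add_zero 0) (add_zero 0) (add_zero 0) (add_zero 0),
      ← D.assoc (add_zero 0) (add_zero 0) (add_zero 0) (add_zero 0) C.snd, ← map_add,
      ← LinearMap.add_apply, ← map_add, C.fst_inl_add_snd_inr, D.one_comp, h]

/-- The composition of isomorphisms of degrees `0` and `n`. -/
def trans {x y z : D.Ob} {n : ℤ} (e : D.IsoOfDegree x y 0) (e' : D.IsoOfDegree y z n) :
    D.IsoOfDegree x z n where
  hom := D.comp (zero_add n) e.hom e'.hom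
  inv := D.comp (add_zero (-n)) e'.inv (e.inv : (D.Hom y x).X 0)
  d_hom := by
    rw [D.d_comp_of_d_eq_zero (zero_add n) rfl rfl rfl e.d_hom, e'.d_hom, map_zero]
  d_inv := by
    have hd : (D.Hom y x).d 0 1 (e.inv : (D.Hom y x).X 0) = 0 := e.d_inv
    rw [D.d_comp_of_d_eq_zero (add_zero (-n)) rfl (zero_add 1) rfl e'.d_inv, hd, map_zero]
  hom_inv_id := by
    have h : D.comp (add_zero 0) e.hom (e.inv : (D.Hom y x).X 0) = D.one x := e.hom_inv_id
    rw [← D.assoc (add_neg_cancel n) (add_zero (-n)) (add_zero 0) (add_neg_cancel n),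
      D.assoc (zero_add n) (add_neg_cancel n) (add_neg_cancel n) (zero_add 0), e'.hom_inv_id,
      D.comp_one, h]
  inv_hom_id := by
    have h : D.comp (zero_add n) (e.inv : (D.Hom y x).X 0) (D.comp (zero_add n) e.hom e'.hom) =
      e'.hom := e.inv_hom_comp (zero_add n) (zero_add n) e'.hom
    rw [D.assoc (add_zero (-n)) (zero_add n) (neg_add_cancel n) (neg_add_cancel n), h,
      e'.inv_hom_id]

/-- An isomorphism in a full dg subcategory. -/
def full {I : Type w₁} {i : I → D.Ob} {x y : I} {n : ℤ} (e : D.IsoOfDegree (i x) (i y) n) :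
    (D.full i).IsoOfDegree x y n where
  hom := e.hom
  inv := e.inv
  d_hom := e.d_hom
  d_inv := e.d_inv
  hom_inv_id := e.hom_inv_id
  inv_hom_id := e.inv_hom_id

end IsoOfDegree

/-- A cone in a full dg subcategory. -/
def ConeData.full {I : Type w₁} {i : I → D.Ob} {a b c : I} {f : (D.Hom (i a) (i b)).X 0}
    (C : D.ConeData f (i c)) : (D.full i).ConeData (a := a) (b := b) f c where
  inl := C.inl
  inr := C.inr
  fst := C.fst
  snd := C.snd
  d_inl := C.d_inl
  d_inr := C.d_inr
  d_fst := C.d_fst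
  d_snd := C.d_snd
  inl_fst := C.inl_fst
  inl_snd := C.inl_snd
  inr_fst := C.inr_fst
  inr_snd := C.inr_snd
  fst_inl_add_snd_inr := C.fst_inl_add_snd_inr

/-- Conjugation by isomorphisms of degree `0`, as a morphism of complexes. -/
def conj {x x' y y' : D.Ob} (e : D.IsoOfDegree x' x 0) (e' : D.IsoOfDegree y' y 0) :
    D.Hom x y ⟶ D.Hom x' y' where
  f n := ModuleCat.ofHom ((D.comp (zero_add n) e.hom).comp
    ((D.comp (add_zero n)).flip (e'.inv : (D.Hom y y').X 0)))
  comm' m n h := by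
    refine ModuleCat.hom_ext (LinearMap.ext fun f => ?_)
    have hd : (D.Hom y y').d 0 1 (e'.inv : (D.Hom y y').X 0) = 0 := e'.d_inv
    change (D.Hom x' y').d m n (D.comp (zero_add m) e.hom (D.comp (add_zero m) f
      (e'.inv : (D.Hom y y').X 0))) = D.comp (zero_add n) e.hom (D.comp (add_zero n)
        ((D.Hom x y).d m n f) (e'.inv : (D.Hom y y').X 0))
    rw [D.d_comp_of_d_eq_zero (zero_add m) (zero_add 1) h h e.d_hom,
      D.d_comp_of_d_eq_zero' (add_zero m) h (zero_add 1) h f hd, Int.negOnePow_zero, one_smul]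

lemma conj_apply {x x' y y' : D.Ob} (e : D.IsoOfDegree x' x 0) (e' : D.IsoOfDegree y' y 0) {n : ℤ}
    (f : (D.Hom x y).X n) : (conj e e').f n f = D.comp (zero_add n) e.hom
      (D.comp (add_zero n) f (e'.inv : (D.Hom y y').X 0)) := rfl

lemma conj_bijective {x x' y y' : D.Ob} (e : D.IsoOfDegree x' x 0) (e' : D.IsoOfDegree y' y 0)
    (n : ℤ) : Function.Bijective ((conj e e').f n) := by
  refine ⟨fun f g h => ?_, fun f => ⟨D.comp (zero_add n) (e.inv : (D.Hom x x').X 0)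
    (D.comp (add_zero n) f e'.hom), ?_⟩⟩
  · rw [conj_apply, conj_apply] at h
    have h₁ (f : (D.Hom x y').X n) : D.comp (zero_add n) (e.inv : (D.Hom x x').X 0)
      (D.comp (zero_add n) e.hom f) = f := e.inv_hom_comp (zero_add n) (zero_add n) f
    have h₂ (f : (D.Hom x y).X n) : D.comp (add_zero n) (D.comp (add_zero n) f
      (e'.inv : (D.Hom y y').X 0)) e'.hom = f := e'.comp_inv_hom (add_zero n) (add_zero n) f
    rw [← h₂ f, ← h₁ (D.comp (add_zero n) f _), h, h₁, h₂]
  · have h₁ : D.comp (zero_add n) e.hom (D.comp (zero_add n) (e.inv : (D.Hom x x').X 0) f) =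
      f := e.hom_inv_comp (zero_add n) (zero_add n) f
    have h₂ : D.comp (add_zero n) (D.comp (add_zero n) f e'.hom)
      (e'.inv : (D.Hom y y').X 0) = f := e'.comp_hom_inv (add_zero n) (add_zero n) f
    rw [conj_apply, D.assoc (zero_add n) (add_zero n) (add_zero n) (zero_add n), h₂, h₁]

end DGCat

/-- Replacing the values of a dg functor by isomorphic objects of a full dg subcategory. -/
def DGFunctor.transport {A : DGCat.{w₁} k} {B : DGCat.{w₂} k} (F : DGFunctor A B) {I : Type w₃}
    {i : I → B.Ob} (o : A.Ob → I) (e : ∀ x, B.IsoOfDegree (i (o x)) (F.obj x) 0) :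
    DGFunctor A (B.full i) where
  obj := o
  map x y := F.map x y ≫ DGCat.conj (e x) (e y)
  map_one x := by
    have h : B.comp (add_zero 0) (e x).hom ((e x).inv : (B.Hom (F.obj x) (i (o x))).X 0) =
      B.one (i (o x)) := (e x).hom_inv_id
    have h₁ : (DGCat.conj (e x) (e x)).f 0 ((F.map x x).f 0 (A.one x)) = B.one (i (o x)) := by
      rw [F.map_one, DGCat.conj_apply, B.one_comp, h]
    exact h₁
  map_comp {x y z p q n} h f g := by
    have h₁ : (DGCat.conj (e x) (e z)).f n ((F.map x z).f n (A.comp h f g)) =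
        B.comp h ((DGCat.conj (e x) (e y)).f p ((F.map x y).f p f))
          ((DGCat.conj (e y) (e z)).f q ((F.map y z).f q g)) := by
      have h₂ (t : (B.Hom (F.obj y) (i (o z))).X q) : B.comp (zero_add q)
        ((e y).inv : (B.Hom (F.obj y) (i (o y))).X 0) (B.comp (zero_add q) (e y).hom t) = t :=
          (e y).inv_hom_comp (zero_add q) (zero_add q) t
      rw [F.map_comp h, DGCat.conj_apply, DGCat.conj_apply, DGCat.conj_apply,
        B.assoc (zero_add p) h h (zero_add n), B.assoc (add_zero p) (zero_add q) h h, h₂,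
        B.assoc h (add_zero q) (add_zero n) h]
    exact h₁

/-! ### Modules of bounded size -/

/-- A complex of `k`-vector spaces that embed into `S` is isomorphic to a complex whose underlying
sets are subsets of `S`. -/
lemma BoundedComplex.exists_iso {S : Type u} (K : CochainComplex (ModuleCat.{u} k) ℤ)
    (hK : ∀ n, Cardinal.mk (K.X n) ≤ Cardinal.mk S) :
    ∃ K' : BoundedComplex k S, Nonempty (K'.toComplex ≅ K) := by
  let i (n : ℤ) : K.X n ↪ S := ((Cardinal.le_def (K.X n) S).1 (hK n)).some
  let E (n : ℤ) : Set.range (i n) ≃ K.X n := (Equiv.ofInjective (i n) (i n).injective).symm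
  let (n : ℤ) : AddCommGroup (Set.range (i n)) := (E n).addCommGroup
  let (n : ℤ) : Module k (Set.range (i n)) := (E n).module k
  let L (n : ℤ) : Set.range (i n) ≃ₗ[k] K.X n := (E n).linearEquiv k
  let K' : BoundedComplex k S :=
    { carrier := fun n => Set.range (i n)
      d := fun n => (L (n + 1)).symm.toLinearMap.comp ((K.d n (n + 1)).hom.comp (L n).toLinearMap)
      d_comp_d := fun n => by
        ext z
        simp [CochainComplex.d_d_apply] }
  refine ⟨K', ⟨HomologicalComplex.Hom.isoOfComponents
    (fun n => (L n).toModuleIso) fun m n h => ?_⟩⟩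
  obtain rfl : m + 1 = n := h
  have hd : K'.toComplex.d m (m + 1) = ModuleCat.ofHom (K'.d m) := CochainComplex.of_d
    (fun n => ModuleCat.of k (K'.carrier n)) (fun n => ModuleCat.ofHom (K'.d n)) m
  rw [hd]
  refine ModuleCat.hom_ext (LinearMap.ext fun z => ?_)
  change K.d m (m + 1) (L m z) = L (m + 1) ((L (m + 1)).symm (K.d m (m + 1) (L m z)))
  rw [LinearEquiv.apply_symm_apply]

/-- An isomorphism of complexes, as an isomorphism in the dg category of complexes. -/
def DGCat.chIso {K L : CochainComplex (ModuleCat.{u} k) ℤ} (e : K ≅ L) :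
    (DGCat.ch k).IsoOfDegree K L 0 where
  hom := Cochain.ofHom e.hom
  inv := Cochain.ofHom e.inv
  d_hom := δ_ofHom e.hom
  d_inv := δ_ofHom e.inv
  hom_inv_id := (Cochain.ofHom_comp e.hom e.inv).symm.trans (congrArg _ e.hom_inv_id)
  inv_hom_id := (Cochain.ofHom_comp e.inv e.hom).symm.trans (congrArg _ e.inv_hom_id)

namespace DGModule

variable {T : DGCat.{u} k} {S : Type u}

/-- A module whose values embed into `S` is isomorphic to one with values in complexes whose
underlying sets are subsets of `S`. -/
lemma exists_bounded_iso (M : DGModule T)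
    (hM : ∀ x n, Cardinal.mk ((M.cx x).X n) ≤ Cardinal.mk S) :
    ∃ M' : (T.boundedModules S).Ob,
      Nonempty (T.modules.IsoOfDegree (DGCat.boundedModules.toModule M') M 0) := by
  choose o e using fun x => BoundedComplex.exists_iso (S := S) (M.cx x) (hM x)
  let ε (x : T.Ob) := DGCat.chIso (e x).some
  let M' : DGFunctor T.op ((DGCat.ch k).full (BoundedComplex.toComplex (S := S))) :=
    DGFunctor.transport M o ε
  refine ⟨M', ⟨?_⟩⟩
  have hact {x y : T.Ob} {n : ℤ} (f : (T.Hom y x).X n) :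
      DGModule.act (DGCat.boundedModules.toModule M') f =
        (Cochain.ofHom (e x).some.hom).comp ((M.act f).comp (Cochain.ofHom (e y).some.inv)
          (add_zero n)) (zero_add n) := rfl
  have h₁ {x y : T.Ob} {p : ℤ} (f : (T.Hom y x).X p) :
      ((Cochain.ofHom (e x).some.hom).comp ((M.act f).comp (Cochain.ofHom (e y).some.inv)
        (add_zero p)) (zero_add p)).comp (Cochain.ofHom (e y).some.hom) (add_zero p) =
        (Cochain.ofHom (e x).some.hom).comp (M.act f) (zero_add p) := by
    rw [Cochain.comp_assoc_of_third_is_zero_cochain, Cochain.comp_assoc_of_third_is_zero_cochain,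
      ← Cochain.ofHom_comp, Iso.inv_hom_id, Cochain.comp_id]
  have h₂ {x y : T.Ob} {p : ℤ} (f : (T.Hom y x).X p) :
      (M.act f).comp (Cochain.ofHom (e y).some.inv) (add_zero p) =
        (Cochain.ofHom (e x).some.inv).comp ((Cochain.ofHom (e x).some.hom).comp ((M.act f).comp
          (Cochain.ofHom (e y).some.inv) (add_zero p)) (zero_add p)) (zero_add p) := by
    rw [← Cochain.comp_assoc_of_first_is_zero_cochain, ← Cochain.ofHom_comp, Iso.inv_hom_id,
      Cochain.id_comp]
  exact
    { hom := mkNat (fun x => Cochain.ofHom (e x).some.hom) fun x y p m h h' f => by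
        obtain rfl : p = m := by omega
        rw [zero_mul, Int.negOnePow_zero, one_smul, hact]
        exact h₁ f
      inv := (mkNat (n := 0) (fun x => Cochain.ofHom (e x).some.inv) fun x y p m h h' f => by
        obtain rfl : p = m := by omega
        rw [zero_mul, Int.negOnePow_zero, one_smul, hact]
        exact h₂ f : (T.modules.Hom M (DGCat.boundedModules.toModule M')).X 0)
      d_hom := Subtype.ext (funext fun x => δ_ofHom (e x).some.hom)
      d_inv := Subtype.ext (funext fun x => δ_ofHom (e x).some.inv)
      hom_inv_id := Subtype.ext (funext fun x => (ε x).hom_inv_id)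
      inv_hom_id := Subtype.ext (funext fun x => (ε x).inv_hom_id) }

end DGModule

end Transport

/-! ### The Yoneda embedding into bounded cofibrant modules -/

section Embedding

variable {k : Type u} [Field k]

namespace DGModule

variable {T : DGCat.{u} k}

lemma isFibrant (M : DGModule T) : M.IsFibrant := fun _ _ t =>
  ⟨0, (map_zero _).trans (zero_cx_eq_zero t).symm⟩

lemma isCofibrant_zero : (zero T).IsCofibrant := by
  rw [isCofibrant_iff_exists_lift]
  exact fun P Q ψ _ _ φ => ⟨⟨fun _ => 0, by simp⟩, zero_hom_ext _ _⟩

lemma one_zero : T.modules.one (zero T) = 0 :=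
  nat_ext fun x p q h z => by
    rw [zero_cx_eq_zero z, map_zero, map_zero]

/-- The isomorphism of the Yoneda lemma, as a morphism of complexes. -/
def yonedaMap (M : DGModule T) (a : T.Ob) : M.cx a ⟶ T.modules.Hom (representable a) M where
  f n := ModuleCat.ofHom
    { toFun := fun z => M.yonedaNat z
      map_add' := fun z z' => yoneda_ext <| (M.eval_yonedaNat_one _).trans <|
        (congrArg₂ (· + ·) (M.eval_yonedaNat_one z).symm (M.eval_yonedaNat_one z').symm).trans
          (map_add ((eval a (zero_add n)).flip (T.one a : ((representable a).cx a).X 0))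
            (M.yonedaNat z) (M.yonedaNat z')).symm
      map_smul' := fun c z => yoneda_ext <| (M.eval_yonedaNat_one _).trans <|
        (congrArg (c • ·) (M.eval_yonedaNat_one z).symm).trans
          (map_smul ((eval a (zero_add n)).flip (T.one a : ((representable a).cx a).X 0)) c
            (M.yonedaNat z)).symm }
  comm' _ _ h := ModuleCat.hom_ext (LinearMap.ext fun z => M.d_yonedaNat h z)

lemma yonedaMap_bijective (M : DGModule T) (a : T.Ob) (n : ℤ) :
    Function.Bijective ((M.yonedaMap a).f n) := by
  constructor
  · intro z z' (h : M.yonedaNat z = M.yonedaNat z')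
    rw [← M.eval_yonedaNat_one z, h, M.eval_yonedaNat_one]
  · intro α
    exact ⟨eval a (zero_add n) α (T.one a : ((representable a).cx a).X 0),
      yoneda_ext (eval_yonedaNat_one M _)⟩

/-- The Yoneda embedding. -/
def yoneda (T : DGCat.{u} k) : DGFunctor T T.modules where
  obj := representable
  map x y := (representable y).yonedaMap x
  map_one x := by
    have h : (representable x).yonedaNat (T.one x : ((representable x).cx x).X 0) =
        T.modules.one (representable x) := by
      refine yoneda_ext ((eval_yonedaNat_one (representable x) _).trans ?_)
      exact (eval_one (M := representable x) x (T.one x)).symm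
    exact h
  map_comp {x y z p q n} h f g := by
    have h₁ : (representable z).yonedaNat (T.comp h f g : ((representable z).cx x).X n) =
        T.modules.comp h ((representable y).yonedaNat f) ((representable z).yonedaNat g) := by
      refine yoneda_ext ((eval_yonedaNat_one (representable z) _).trans ?_)
      refine Eq.trans ?_ (eval_comp x (zero_add p) h h (zero_add n) _ _ _).symm
      refine Eq.trans ?_ (congrArg _ (eval_yonedaNat_one (representable y) f)).symm
      refine Eq.trans ?_ (eval_yonedaNat (representable z) g h f).symm
      refine Eq.trans ?_ (congrArg _ (representable_smul z (by omega) f g)).symm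
      have h₂ : (q * p).negOnePow • (p * q).negOnePow • T.comp h f g = T.comp h f g := by
        rw [negOnePow_smul_smul, negOnePow_smul_congr (b := 0) ⟨q * p, by ring⟩,
          Int.negOnePow_zero, one_smul]
      exact h₂.symm
    exact h₁

/-- A dg projective module is isomorphic to an object of `T.boundedCofibrantFibrantModules S` as
soon as its values embed into `S`. -/
lemma exists_boundedCofibrantFibrant_iso {S : Type u} (M : DGModule T) (hM : M.IsDGProjective)
    (hS : ∀ x n, Cardinal.mk ((M.cx x).X n) ≤ Cardinal.mk S) :
    ∃ M' : (T.boundedCofibrantFibrantModules S).Ob,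
      Nonempty (T.modules.IsoOfDegree (DGCat.boundedModules.toModule M'.1) M 0) := by
  obtain ⟨M', ⟨e⟩⟩ := M.exists_bounded_iso hS
  exact ⟨⟨M', (hM.of_isoOfDegree e).isCofibrant, isFibrant _⟩, ⟨e⟩⟩

lemma mk_cofiber_le {S : Type u} (hS : Cardinal.aleph0 ≤ Cardinal.mk S) {M N : DGModule T}
    (φ : M ⟶ N) (hM : ∀ x n, Cardinal.mk ((M.cx x).X n) ≤ Cardinal.mk S)
    (hN : ∀ x n, Cardinal.mk ((N.cx x).X n) ≤ Cardinal.mk S) (x : T.Ob) (n : ℤ) :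
    Cardinal.mk (((cofiber φ).cx x).X n) ≤ Cardinal.mk S := by
  have h : Function.Injective fun t : ((cofiber φ).cx x).X n =>
      (cofiberFst φ x rfl t, cofiberSnd φ x n t) := fun t t' h =>
    cofiber_ext rfl (congrArg Prod.fst h) (congrArg Prod.snd h)
  calc Cardinal.mk (((cofiber φ).cx x).X n)
      ≤ Cardinal.mk ((M.cx x).X (n + 1) × (N.cx x).X n) := Cardinal.mk_le_of_injective h
    _ = Cardinal.mk ((M.cx x).X (n + 1)) * Cardinal.mk ((N.cx x).X n) := by
      rw [Cardinal.mk_prod, Cardinal.lift_id, Cardinal.lift_id]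
    _ ≤ Cardinal.mk S * Cardinal.mk S := mul_le_mul' (hM x _) (hN x n)
    _ = Cardinal.mk S := Cardinal.mul_eq_self hS

lemma mk_toModule_le {S : Type u} (M : (T.boundedModules S).Ob) (x : T.Ob) (n : ℤ) :
    Cardinal.mk (((DGCat.boundedModules.toModule M).cx x).X n) ≤ Cardinal.mk S :=
  Cardinal.mk_set_le _

end DGModule

open DGModule

namespace DGCat

variable (T : DGCat.{u} k) (S : Type u)

/-- Shifts and mapping cones of dg projective modules with values that embed into an infinite set `S`
are again dg projective with values that embed into `S`, hence isomorphic to objects of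
`T.boundedCofibrantFibrantModules S`. -/
lemma isPretriangulated_boundedCofibrantFibrantModules (hS : Cardinal.aleph0 ≤ Cardinal.mk S) :
    (T.boundedCofibrantFibrantModules S).IsPretriangulated := by
  have hproj (M : (T.boundedCofibrantFibrantModules S).Ob) :
    (boundedModules.toModule M.1).IsDGProjective := IsCofibrant.isDGProjective M.2.1
  obtain ⟨o, ⟨e⟩⟩ := (zero T).exists_boundedCofibrantFibrant_iso (S := S)
    isCofibrant_zero.isDGProjective fun x n => by
      have : Subsingleton (((zero T).cx x).X n) :=
        ⟨fun a b => (zero_cx_eq_zero a).trans (zero_cx_eq_zero b).symm⟩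
      exact (Cardinal.le_one_iff_subsingleton.2 this).trans (Cardinal.one_le_aleph0.trans hS)
  -- by definition, the dg category in question is a full dg subcategory of all modules
  change (T.modules.full fun M : (T.boundedCofibrantFibrantModules S).Ob =>
    boundedModules.toModule M.1).IsPretriangulated
  refine DGCat.isPretriangulated_of_exists _ o ?_ (fun c => ?_) fun a b
    (f : (T.modules.Hom (boundedModules.toModule a.1) (boundedModules.toModule b.1)).X 0)
    (hf : (T.modules.Hom (boundedModules.toModule a.1)
      (boundedModules.toModule b.1)).d 0 1 f = 0) => ?_
  · have h : T.modules.one (boundedModules.toModule o.1) = 0 := by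
      rw [← e.hom_inv_id, ← T.modules.comp_one e.hom, one_zero, map_zero, map_zero,
        LinearMap.zero_apply]
    exact h
  · obtain ⟨d, ⟨e'⟩⟩ := ((boundedModules.toModule c.1).shift
      (-1)).exists_boundedCofibrantFibrant_iso (S := S)
        ((hproj c).of_isoOfDegree (shiftIso _ (-1))) fun x n => mk_toModule_le c.1 x (n + -1)
    exact ⟨d, ⟨IsoOfDegree.full (D := T.modules) (e'.trans (shiftIso _ (-1)))⟩⟩
  · let φ : boundedModules.toModule a.1 ⟶ boundedModules.toModule b.1 := homOfNat f hf
    obtain ⟨c, ⟨e'⟩⟩ := (cofiber φ).exists_boundedCofibrantFibrant_iso (S := S)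
      ((hproj a).of_coneData (cofiberConeData φ) (hproj b))
      (mk_cofiber_le hS φ (mk_toModule_le a.1) (mk_toModule_le b.1))
    have C : T.modules.ConeData (natOfHom φ) (boundedModules.toModule c.1) :=
      e'.coneData (cofiberConeData φ)
    have hφ : natOfHom φ = f := natOfHom_homOfNat f hf
    rw [hφ] at C
    exact ⟨c, ⟨ConeData.full (D := T.modules) C⟩⟩

/-- Representable modules are cofibrant, so that the Yoneda embedding, corrected by isomorphisms,
takes values in the bounded cofibrant modules over any `S` into which all complexes of morphisms embed. -/
lemma exists_isDKEmbedding_boundedCofibrantFibrantModules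
    (hS : ∀ x y n, Cardinal.mk ((T.Hom x y).X n) ≤ Cardinal.mk S) :
    ∃ F : DGFunctor T (T.boundedCofibrantFibrantModules S), F.IsDKEmbedding := by
  -- the transported Yoneda embedding is even bijective on morphisms of each degree
  choose o e using fun c => (representable c).exists_boundedCofibrantFibrant_iso (S := S)
    (isDGProjective_representable c) fun x n => hS x c n
  refine ⟨DGFunctor.transport (i := fun M : (T.boundedCofibrantFibrantModules S).Ob =>
    boundedModules.toModule M.1) (yoneda T) o fun c => (e c).some, fun x y => ?_⟩
  exact CochainComplex.quasiIso_of_bijective _ fun n =>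
    (conj_bijective (D := T.modules) (e x).some (e y).some n).comp
      ((representable y).yonedaMap_bijective x n)

end DGCat

end Embedding

theorem mainTheorem7 {k : Type u} [Field k] [CharZero k] (T : DGCat.{u} k) :
    (∃ (T' : DGCat.{u} k) (F : DGFunctor T T'), T'.IsPretriangulated ∧ F.IsDKEmbedding) ∧
    ∃ κ : Cardinal.{u}, ∀ S : Type u, κ ≤ Cardinal.mk S →
      (T.boundedCofibrantFibrantModules S).IsPretriangulated ∧
      ∃ F : DGFunctor T (T.boundedCofibrantFibrantModules S), F.IsDKEmbedding := by
  have h : ∃ κ : Cardinal.{u}, ∀ S : Type u, κ ≤ Cardinal.mk S →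
      (T.boundedCofibrantFibrantModules S).IsPretriangulated ∧
      ∃ F : DGFunctor T (T.boundedCofibrantFibrantModules S), F.IsDKEmbedding := by
    -- an infinite cardinal that bounds all the vector spaces of morphisms of `T`
    refine ⟨max Cardinal.aleph0 (Cardinal.sum fun i : T.Ob × T.Ob × ℤ =>
      Cardinal.mk ((T.Hom i.1 i.2.1).X i.2.2)), fun S hS => ?_⟩
    exact ⟨T.isPretriangulated_boundedCofibrantFibrantModules S ((le_max_left _ _).trans hS),
      T.exists_isDKEmbedding_boundedCofibrantFibrantModules S fun x y n =>
        (Cardinal.le_sum (fun i : T.Ob × T.Ob × ℤ => Cardinal.mk ((T.Hom i.1 i.2.1).X i.2.2))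
          (x, y, n)).trans ((le_max_right _ _).trans hS)⟩
  refine ⟨?_, h⟩
  obtain ⟨κ, hκ⟩ := h
  obtain ⟨h₁, F, hF⟩ := hκ κ.out (Cardinal.mk_out κ).ge
  exact ⟨_, F, h₁, hF⟩
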